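/- Let $\mathcal{M}$ be an $\mathbb{N}$-graded manifold over a smooth manifold $M$: a sheaf of non-negatively graded, graded-commutative $\mathbb{R}$-algebras on $M$ whose degree $0$ part is $C^\infty_M$ and which is locally freely generated over it, as a graded-commutative algebra, by finitely many coordinates of positive degrees. Functions, vector fields (graded derivations of the sheaf) and forms are finite sums of homogeneous ones, and vector fields act on forms through the graded Cartan calculus $$\mathcal{L}_X=\iota_X d+(-1)^{|X|}d\iota_X,\qquad \iota_{[X,Y]}=\mathcal{L}_X\iota_Y-(-1)^{|X|(|Y|-1)}\iota_Y\mathcal{L}_X,\qquad \iota_Y(f\beta)=(-1)^{(|Y|-1)|f|}f\,\iota_Y\beta.$$ Let $n\ge 0$ and let $\alpha$ be a contact $1$-form of degree $n$ on $\mathcal{M}$: it vanishes at no point of $M$, and, with $\mathcal{D}=\ker(X\mapsto\iota_X\alpha)\subseteq T\mathcal{M}$, the map $(d\alpha)^\flat\colon X\mapsto\iota_Xd\alpha$ induces a bijection of sheaves $\mathcal{D}\to\mathcal{D}^*$. A vector field $X$ is called contact if $[X,\Gamma(\mathcal{D})]\subseteq\Gamma(\mathcal{D})$. Then: 1. For every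 function $h$ on $\mathcal{M}$ there are unique $\beta\in\operatorname{im}(d\alpha)^\flat$ and $f\in C^\infty(\mathcal{M})$ with $dh=\beta+f\alpha$. 2. There is a linear bijection $h\mapsto X_h$ from the functions on $\mathcal{M}$ to the contact vector fields on $\mathcal{M}$, with $\iota_{X_h}\alpha=h$ for all $h$. For $h$ homogeneous of degree $k$ with $dh=\beta+f\alpha$ as in 1, $X_h$ is the unique vector field such that $$\iota_{X_h}d\alpha=(-1)^{k-n+1}\beta,\qquad \iota_{X_h}\alpha=h.$$ 3. For every integer $k$, a function $h$ is of degree $k$ if and only if $X_h$ is of degree $k-n$. -/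

import Mathlib

open scoped Manifold ContDiff DirectSum
open TopologicalSpace

/-- The algebra of smooth real functions on an open subset `U` of a manifold of dimension `m`. -/
abbrev SmoothFun (m : ℕ) {M : Type*} [TopologicalSpace M]
    [ChartedSpace (EuclideanSpace ℝ (Fin m)) M] (U : Opens M) : Type _ :=
  ContMDiffMap (𝓡 m) (modelWithCornersSelf ℝ ℝ) U ℝ ∞

/-- Restriction of smooth functions to a smaller open subset. -/
noncomputable abbrev SmoothFun.res {m : ℕ} {M : Type*} [TopologicalSpace M]
    [ChartedSpace (EuclideanSpace ℝ (Fin m)) M] {U V : Opens M} (h : V ≤ U) :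
    SmoothFun m U →+* SmoothFun m V :=
  ContMDiffMap.restrictRingHom (𝓡 m) (modelWithCornersSelf ℝ ℝ) ℝ h

/-- Exponents of the monomials in graded-commuting variables `ξ i` of degree `deg i`:
the odd variables square to zero and occur with exponent at most one. -/
def MonomialExp {r : ℕ} (deg : Fin r → ℕ) : Type :=
  {e : Fin r → ℕ // ∀ i, Odd (deg i) → e i ≤ 1}

/-- An `ℕ`-graded manifold over the smooth manifold `M`: a sheaf of graded-commutative algebras
on `M` (graded by `ℤ`, with nothing in negative degrees, the parity of a function being the
parity of its degree) whose part of degree zero is the sheaf of smooth functions and which is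
locally the free graded-commutative algebra over it on `r` generators of positive degrees `deg`.
As usual in the graded setting, functions are finite sums of homogeneous functions, and the
sheaf condition is imposed in each degree. -/
structure NManifold (m : ℕ) (M : Type*) [TopologicalSpace M]
    [ChartedSpace (EuclideanSpace ℝ (Fin m)) M] where
  /-- the functions on the part of the graded manifold over an open subset -/
  A : Opens M → Type*
  [ring : ∀ U, Ring (A U)]
  [algebra : ∀ U, Algebra ℝ (A U)]
  /-- the homogeneous functions of a given degree -/
  gr : ∀ U, ℤ → Submodule ℝ (A U)
  [graded : ∀ U, GradedAlgebra (gr U)]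
  gr_neg : ∀ U k, k < 0 → gr U k = ⊥
  graded_comm : ∀ U i j, ∀ a ∈ gr U i, ∀ b ∈ gr U j, a * b = (-1 : ℝ) ^ (i * j) • (b * a)
  /-- restriction to a smaller open subset -/
  res : ∀ {U V : Opens M}, V ≤ U → (A U →ₐ[ℝ] A V)
  res_refl : ∀ U (a : A U), res (le_refl U) a = a
  res_trans : ∀ {U V W : Opens M} (hVU : V ≤ U) (hWV : W ≤ V) (a : A U),
    res hWV (res hVU a) = res (hWV.trans hVU) a
  res_mem : ∀ {U V : Opens M} (h : V ≤ U) k, ∀ a ∈ gr U k, res h a ∈ gr V k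
  sheaf : ∀ (k : ℤ) (S : Set (Opens M)) (s : ∀ U : S, A U.1), (∀ U, s U ∈ gr U.1 k) →
    (∀ U V : S, res (inf_le_left : U.1 ⊓ V.1 ≤ U.1) (s U) = res inf_le_right (s V)) →
    ∃! a : A (sSup S), a ∈ gr (sSup S) k ∧ ∀ U : S, res (le_sSup U.2) a = s U
  /-- the inclusion of the smooth functions on the body as the functions of degree zero -/
  body : ∀ U, SmoothFun m U →ₐ[ℝ] A U
  body_injective : ∀ U, Function.Injective (body U)
  body_range : ∀ U, Set.range (body U) = gr U 0
  res_body : ∀ {U V : Opens M} (h : V ≤ U) (g : SmoothFun m U),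
    res h (body U g) = body V (SmoothFun.res h g)
  /-- the number of coordinates of positive degree -/
  r : ℕ
  /-- the degrees of these coordinates -/
  deg : Fin r → ℕ
  deg_pos : ∀ i, 0 < deg i
  exists_coordinates : ∀ p : M, ∃ U : Opens M, p ∈ U ∧ ∃ ξ : Fin r → A U,
    (∀ i, ξ i ∈ gr U (deg i)) ∧ ∀ (V : Opens M) (hV : V ≤ U), Function.Bijective
      (fun c : MonomialExp deg →₀ SmoothFun m V =>
        c.sum fun e g => body V g * (List.ofFn fun i => res hV (ξ i) ^ e.1 i).prod)

namespace NManifold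

attribute [instance] NManifold.ring NManifold.algebra NManifold.graded

variable {m : ℕ} {M : Type*} [TopologicalSpace M] [ChartedSpace (EuclideanSpace ℝ (Fin m)) M]
  (𝓜 : NManifold m M)

/-! ### Vector fields -/

/-- Families of linear operators on the functions on the open subsets of `U`. -/
def Operators (U : Opens M) : Type _ :=
  ∀ V : Set.Iic U, 𝓜.A V.1 →ₗ[ℝ] 𝓜.A V.1

instance (U : Opens M) : AddCommGroup (𝓜.Operators U) :=
  inferInstanceAs (AddCommGroup (∀ V : Set.Iic U, 𝓜.A V.1 →ₗ[ℝ] 𝓜.A V.1))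

noncomputable instance (U : Opens M) : Module ℝ (𝓜.Operators U) :=
  inferInstanceAs (Module ℝ (∀ V : Set.Iic U, 𝓜.A V.1 →ₗ[ℝ] 𝓜.A V.1))

namespace Operators

variable {𝓜} {U : Opens M}

@[ext]
theorem ext {X Y : 𝓜.Operators U} (h : ∀ (V : Set.Iic U) (a : 𝓜.A V.1), X V a = Y V a) : X = Y :=
  funext fun V => LinearMap.ext (h V)

@[simp]
theorem zero_apply (V : Set.Iic U) : (0 : 𝓜.Operators U) V = 0 := rfl

@[simp]
theorem add_apply (X Y : 𝓜.Operators U) (V : Set.Iic U) : (X + Y) V = X V + Y V := rfl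

@[simp]
theorem smul_apply (c : ℝ) (X : 𝓜.Operators U) (V : Set.Iic U) : (c • X) V = c • X V := rfl

end Operators

/-- The homogeneous vector fields of degree `k` over `U`: derivations of degree `k` of the sheaf
of functions over `U`. -/
def VectorField (U : Opens M) (k : ℤ) : Submodule ℝ (𝓜.Operators U) where
  carrier := {X |
    (∀ (V W : Set.Iic U) (h : W.1 ≤ V.1) (a : 𝓜.A V.1),
      𝓜.res h (X V a) = X W (𝓜.res h a)) ∧
    (∀ (V : Set.Iic U) (i : ℤ), ∀ a ∈ 𝓜.gr V.1 i, X V a ∈ 𝓜.gr V.1 (k + i)) ∧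
    (∀ (V : Set.Iic U) (i : ℤ), ∀ a ∈ 𝓜.gr V.1 i, ∀ b : 𝓜.A V.1,
      X V (a * b) = X V a * b + (-1 : ℝ) ^ (k * i) • (a * X V b))}
  zero_mem' := ⟨fun _ _ _ _ => by simp, fun _ _ _ _ => by simp, fun _ _ _ _ _ => by simp⟩
  add_mem' := by
    rintro X Y ⟨hX1, hX2, hX3⟩ ⟨hY1, hY2, hY3⟩
    refine ⟨fun V W h a => ?_, fun V i a ha => ?_, fun V i a ha b => ?_⟩
    · simp [hX1 V W h a, hY1 V W h a]
    · exact Submodule.add_mem _ (hX2 V i a ha) (hY2 V i a ha)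
    · simp only [Operators.add_apply, LinearMap.add_apply, hX3 V i a ha b, hY3 V i a ha b, add_mul,
        mul_add, smul_add]
      abel
  smul_mem' := by
    rintro c X ⟨hX1, hX2, hX3⟩
    refine ⟨fun V W h a => ?_, fun V i a ha => ?_, fun V i a ha b => ?_⟩
    · simp [hX1 V W h a]
    · exact Submodule.smul_mem _ c (hX2 V i a ha)
    · simp only [Operators.smul_apply, LinearMap.smul_apply, hX3 V i a ha b, smul_add, smul_mul_assoc,
        mul_smul_comm]
      rw [smul_comm c]

variable {𝓜}

/-- The value of a vector field over `U` on a function over `U`. -/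
def app {U : Opens M} {k : ℤ} (X : 𝓜.VectorField U k) : 𝓜.A U →ₗ[ℝ] 𝓜.A U :=
  X.1 ⟨U, le_refl U⟩

/-- Restriction of a vector field to a smaller open subset. -/
def resVF {U V : Opens M} (h : V ≤ U) (k : ℤ) :
    𝓜.VectorField U k →ₗ[ℝ] 𝓜.VectorField V k where
  toFun X := ⟨fun W => X.1 ⟨W.1, le_trans W.2 h⟩,
    fun V' W => X.2.1 ⟨V'.1, le_trans V'.2 h⟩ ⟨W.1, le_trans W.2 h⟩,
    fun W => X.2.2.1 ⟨W.1, le_trans W.2 h⟩, fun W => X.2.2.2 ⟨W.1, le_trans W.2 h⟩⟩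
  map_add' _ _ := rfl
  map_smul' _ _ := rfl

/-- The product `f X` of a homogeneous function and a homogeneous vector field. -/
def mulVF {U : Opens M} {q k : ℤ} (f : 𝓜.gr U q) (X : 𝓜.VectorField U k) :
    𝓜.VectorField U (q + k) :=
  ⟨fun V => LinearMap.mulLeft ℝ (𝓜.res (Set.mem_Iic.1 V.2) f.1) ∘ₗ X.1 V, by
    refine ⟨fun V W h a => ?_, fun V i a ha => ?_, fun V i a ha b => ?_⟩
    · simp only [LinearMap.comp_apply, LinearMap.mulLeft_apply, map_mul, X.2.1 V W h a,
        𝓜.res_trans (Set.mem_Iic.1 V.2) h]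
    · have := SetLike.mul_mem_graded (𝓜.res_mem (Set.mem_Iic.1 V.2) q f.1 f.2) (X.2.2.1 V i a ha)
      simpa [add_assoc] using this
    · have hc := 𝓜.graded_comm V.1 q i _ (𝓜.res_mem (Set.mem_Iic.1 V.2) q f.1 f.2) a ha
      simp only [LinearMap.comp_apply, LinearMap.mulLeft_apply, X.2.2.2 V i a ha b, mul_add,
        mul_smul_comm]
      rw [← mul_assoc _ a, hc, add_mul q k i, zpow_add₀ (by norm_num), smul_mul_assoc, smul_smul,
        mul_comm ((-1 : ℝ) ^ (k * i)), mul_assoc, mul_assoc]⟩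

/-- The graded Lie bracket `[X, Y] = X Y - (-1) ^ (|X| |Y|) Y X` of homogeneous vector fields. -/
noncomputable def bracket {U : Opens M} {i j : ℤ} (X : 𝓜.VectorField U i) (Y : 𝓜.VectorField U j) :
    𝓜.VectorField U (i + j) :=
  ⟨fun V => X.1 V ∘ₗ Y.1 V - (-1 : ℝ) ^ (i * j) • (Y.1 V ∘ₗ X.1 V), by
    refine ⟨fun V W h a => ?_, fun V k a ha => ?_, fun V k a ha b => ?_⟩
    · simp [X.2.1 V W h, Y.2.1 V W h]
    · refine Submodule.sub_mem _ ?_ (Submodule.smul_mem _ _ ?_)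
      · have := X.2.2.1 V _ _ (Y.2.2.1 V k a ha)
        simpa [add_assoc] using this
      · have := Y.2.2.1 V _ _ (X.2.2.1 V k a ha)
        rw [← add_assoc, add_comm j i] at this
        exact this
    · have hs : (-1 : ℝ) ^ (i * j) * (-1 : ℝ) ^ (i * j) = 1 := by
        rw [← zpow_add₀ (by norm_num), ← two_mul, zpow_mul]; norm_num
      have e1 : (-1 : ℝ) ^ (i * (j + k)) = (-1 : ℝ) ^ (i * j) * (-1 : ℝ) ^ (i * k) := by
        rw [← zpow_add₀ (by norm_num), mul_add]
      have e2 : (-1 : ℝ) ^ (j * (i + k)) = (-1 : ℝ) ^ (i * j) * (-1 : ℝ) ^ (j * k) := by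
        rw [← zpow_add₀ (by norm_num), mul_add, mul_comm j i]
      have e3 : (-1 : ℝ) ^ ((i + j) * k) = (-1 : ℝ) ^ (i * k) * (-1 : ℝ) ^ (j * k) := by
        rw [← zpow_add₀ (by norm_num), add_mul]
      simp only [LinearMap.sub_apply, LinearMap.smul_apply, LinearMap.comp_apply,
        X.2.2.2 V k a ha b, Y.2.2.2 V k a ha b, map_add, map_smul,
        X.2.2.2 V _ _ (Y.2.2.1 V k a ha) b, Y.2.2.2 V _ _ (X.2.2.1 V k a ha) b,
        X.2.2.2 V k a ha (Y.1 V b), Y.2.2.2 V k a ha (X.1 V b), e1, e2, e3]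
      simp only [sub_mul, mul_sub, smul_mul_assoc, mul_smul_comm, smul_add, smul_sub, smul_smul]
      generalize (-1 : ℝ) ^ (i * j) = s at *
      match_scalars <;> first | linear_combination (-(-1 : ℝ) ^ (j * k)) * hs | ring⟩

/-- The vector fields over `U`: finite sums of homogeneous ones. -/
def VF (𝓜 : NManifold m M) (U : Opens M) : Type _ :=
  DirectSum ℤ fun k => 𝓜.VectorField U k

noncomputable instance (U : Opens M) : AddCommGroup (𝓜.VF U) :=
  inferInstanceAs (AddCommGroup (DirectSum ℤ fun k => 𝓜.VectorField U k))

noncomputable instance (U : Opens M) : Module ℝ (𝓜.VF U) :=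
  inferInstanceAs (Module ℝ (DirectSum ℤ fun k => 𝓜.VectorField U k))

/-- The inclusion of the homogeneous vector fields of degree `k` into all vector fields. -/
noncomputable def ofVF {U : Opens M} (k : ℤ) : 𝓜.VectorField U k →ₗ[ℝ] 𝓜.VF U :=
  DirectSum.lof ℝ ℤ (fun k => 𝓜.VectorField U k) k

/-- The linear extension to all vector fields of linear maps on the homogeneous ones. -/
noncomputable def liftVF {U : Opens M} {E : Type*} [AddCommMonoid E] [Module ℝ E]
    (F : ∀ k : ℤ, 𝓜.VectorField U k →ₗ[ℝ] E) : 𝓜.VF U →ₗ[ℝ] E :=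
  DirectSum.toModule ℝ ℤ E F

/-- Restriction of vector fields, extended linearly. -/
noncomputable def resVFTotal {U V : Opens M} (h : V ≤ U) : 𝓜.VF U →ₗ[ℝ] 𝓜.VF V :=
  liftVF fun k => ofVF k ∘ₗ resVF h k

theorem bracket_apply {U : Opens M} {i j : ℤ} (X : 𝓜.VectorField U i) (Y : 𝓜.VectorField U j)
    (V : Set.Iic U) (a : 𝓜.A V.1) :
    (bracket X Y).1 V a = X.1 V (Y.1 V a) - (-1 : ℝ) ^ (i * j) • Y.1 V (X.1 V a) := rfl

/-- The graded Lie bracket as a bilinear map. -/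
noncomputable def bracketHom (U : Opens M) (i j : ℤ) :
    𝓜.VectorField U i →ₗ[ℝ] 𝓜.VectorField U j →ₗ[ℝ] 𝓜.VectorField U (i + j) :=
  LinearMap.mk₂ ℝ bracket
    (fun X₁ X₂ Y => by
      ext V a
      simp only [bracket_apply, Submodule.coe_add, Operators.add_apply, LinearMap.add_apply,
        map_add]
      module)
    (fun c X Y => by
      ext V a
      simp only [bracket_apply, Submodule.coe_smul, Operators.smul_apply, LinearMap.smul_apply,
        map_smul]
      module)
    (fun X Y₁ Y₂ => by
      ext V a
      simp only [bracket_apply, Submodule.coe_add, Operators.add_apply, LinearMap.add_apply,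
        map_add]
      module)
    (fun c X Y => by
      ext V a
      simp only [bracket_apply, Submodule.coe_smul, Operators.smul_apply, LinearMap.smul_apply,
        map_smul]
      module)

/-- The graded Lie bracket, extended bilinearly to all vector fields. -/
noncomputable def bracketTotal (U : Opens M) : 𝓜.VF U →ₗ[ℝ] 𝓜.VF U →ₗ[ℝ] 𝓜.VF U :=
  liftVF fun i => LinearMap.flip (liftVF fun j =>
    LinearMap.flip ((bracketHom U i j).compr₂ (ofVF (i + j))))

/-! ### Differential forms of degree one -/

/-- Families of linear maps `Y ↦ ι_Y β` on the homogeneous vector fields over the open subsets of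
`U`. -/
def Pairings (𝓜 : NManifold m M) (U : Opens M) : Type _ :=
  ∀ (V : Set.Iic U) (k : ℤ), 𝓜.VectorField V.1 k →ₗ[ℝ] 𝓜.A V.1

noncomputable instance (U : Opens M) : AddCommGroup (𝓜.Pairings U) :=
  inferInstanceAs (AddCommGroup (∀ (V : Set.Iic U) (k : ℤ), 𝓜.VectorField V.1 k →ₗ[ℝ] 𝓜.A V.1))

noncomputable instance (U : Opens M) : Module ℝ (𝓜.Pairings U) :=
  inferInstanceAs (Module ℝ (∀ (V : Set.Iic U) (k : ℤ), 𝓜.VectorField V.1 k →ₗ[ℝ] 𝓜.A V.1))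

namespace Pairings

variable {U : Opens M}

@[ext]
theorem ext {β γ : 𝓜.Pairings U}
    (h : ∀ (V : Set.Iic U) (k : ℤ) (Y : 𝓜.VectorField V.1 k), β V k Y = γ V k Y) : β = γ :=
  funext fun V => funext fun k => LinearMap.ext (h V k)

@[simp]
theorem zero_apply (V : Set.Iic U) (k : ℤ) : (0 : 𝓜.Pairings U) V k = 0 := rfl

@[simp]
theorem add_apply (β γ : 𝓜.Pairings U) (V : Set.Iic U) (k : ℤ) :
    (β + γ) V k = β V k + γ V k := rfl

@[simp]
theorem smul_apply (c : ℝ) (β : 𝓜.Pairings U) (V : Set.Iic U) (k : ℤ) :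
    (c • β) V k = c • β V k := rfl

end Pairings

/-- The `1`-forms of degree `l` over `U`. A `1`-form `β` is given by its contractions `ι_Y β`,
which are left linear in the vector field `Y`. -/
def OneForm (𝓜 : NManifold m M) (U : Opens M) (l : ℤ) : Submodule ℝ (𝓜.Pairings U) where
  carrier := {β |
    (∀ (V W : Set.Iic U) (h : W.1 ≤ V.1) (k : ℤ) (Y : 𝓜.VectorField V.1 k),
      𝓜.res h (β V k Y) = β W k (resVF h k Y)) ∧
    (∀ (V : Set.Iic U) (k : ℤ) (Y : 𝓜.VectorField V.1 k), β V k Y ∈ 𝓜.gr V.1 (k + l)) ∧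
    (∀ (V : Set.Iic U) (q k : ℤ) (f : 𝓜.gr V.1 q) (Y : 𝓜.VectorField V.1 k),
      β V (q + k) (mulVF f Y) = f.1 * β V k Y)}
  zero_mem' := ⟨fun _ _ _ _ _ => by simp, fun _ _ _ => by simp, fun _ _ _ _ _ => by simp⟩
  add_mem' := by
    rintro β γ ⟨h1, h2, h3⟩ ⟨g1, g2, g3⟩
    refine ⟨fun V W h k Y => ?_, fun V k Y => ?_, fun V q k f Y => ?_⟩
    · simp [h1 V W h k Y, g1 V W h k Y]
    · exact Submodule.add_mem _ (h2 V k Y) (g2 V k Y)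
    · simp [h3 V q k f Y, g3 V q k f Y, mul_add]
  smul_mem' := by
    rintro c β ⟨h1, h2, h3⟩
    refine ⟨fun V W h k Y => ?_, fun V k Y => ?_, fun V q k f Y => ?_⟩
    · simp [h1 V W h k Y]
    · exact Submodule.smul_mem _ c (h2 V k Y)
    · simp [h3 V q k f Y]

/-- The contraction `ι_X β` of a `1`-form over `U` with a vector field over a smaller open
subset. -/
def contract {U V : Opens M} {l : ℤ} (h : V ≤ U) (β : 𝓜.OneForm U l) (k : ℤ) :
    𝓜.VectorField V k →ₗ[ℝ] 𝓜.A V :=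
  β.1 ⟨V, h⟩ k

/-- The contraction, extended linearly to all vector fields. -/
noncomputable def contractTotal {U V : Opens M} {l : ℤ} (h : V ≤ U) (β : 𝓜.OneForm U l) :
    𝓜.VF V →ₗ[ℝ] 𝓜.A V :=
  liftVF fun k => contract h β k

/-- The differential `dh` of a function: `ι_Y dh = Y h`. -/
def dFun {U : Opens M} (h : 𝓜.A U) : 𝓜.Pairings U := fun V _ =>
  { toFun := fun Y => app Y (𝓜.res (Set.mem_Iic.1 V.2) h)
    map_add' := fun _ _ => rfl
    map_smul' := fun _ _ => rfl }

/-- The linear map multiplying the functions of degree `p` by `(-1) ^ (q * p)`. -/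
noncomputable def signTwist {U : Opens M} (q : ℤ) : 𝓜.A U →ₗ[ℝ] 𝓜.A U :=
  DirectSum.toModule ℝ ℤ (𝓜.A U) (fun p => (-1 : ℝ) ^ (q * p) • (𝓜.gr U p).subtype) ∘ₗ
    (DirectSum.decomposeLinearEquiv (𝓜.gr U)).toLinearMap

/-- The product `f β` of a function and a `1`-form. Since `ι_Y` is a derivation of total degree
`|Y| - 1`, one has `ι_Y (f β) = (-1) ^ ((|Y| - 1) |f|) f ι_Y β` for homogeneous `f`. -/
noncomputable def mulForm {U : Opens M} {l : ℤ} (f : 𝓜.A U) (β : 𝓜.OneForm U l) :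
    𝓜.Pairings U := fun V k =>
  LinearMap.mulLeft ℝ (signTwist (k - 1) (𝓜.res (Set.mem_Iic.1 V.2) f)) ∘ₗ β.1 V k

/-- The function `ι_Y ι_X dα` for homogeneous vector fields `X`, `Y` of degrees `i`, `j`. The
graded Cartan relations `L_X = ι_X d + (-1) ^ i d ι_X` and
`ι_[X,Y] = L_X ι_Y - (-1) ^ (i * (j - 1)) ι_Y L_X` say that
`ι_Y ι_X dα = (-1) ^ (i * (j - 1)) (X (ι_Y α) - (-1) ^ (i * j) Y (ι_X α) - ι_[X,Y] α)`. -/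
noncomputable def dContract {U V : Opens M} {n : ℤ} (h : V ≤ U) (α : 𝓜.OneForm U n) {i j : ℤ}
    (X : 𝓜.VectorField V i) (Y : 𝓜.VectorField V j) : 𝓜.A V :=
  (-1 : ℝ) ^ (i * (j - 1)) •
    (app X (contract h α j Y) - (-1 : ℝ) ^ (i * j) • app Y (contract h α i X)
      - contract h α (i + j) (bracket X Y))

theorem dContract_mulVF {U V : Opens M} {n : ℤ} (h : V ≤ U) (α : 𝓜.OneForm U n) {i j q : ℤ}
    (X : 𝓜.VectorField V i) (f : 𝓜.gr V q) (Y : 𝓜.VectorField V j) :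
    dContract h α X (mulVF f Y) = f.1 * dContract h α X Y := by
  have hX : app X f.1 ∈ 𝓜.gr V (i + q) := X.2.2.1 ⟨V, le_refl V⟩ q f.1 f.2
  have hb : contract h α (i + (q + j)) (bracket X (mulVF f Y)) =
      app X f.1 * contract h α j Y +
        (-1 : ℝ) ^ (i * q) • (f.1 * contract h α (i + j) (bracket X Y)) := by
    have e1 : app X f.1 * contract h α j Y =
        contract h α (i + q + j) (mulVF ⟨app X f.1, hX⟩ Y) :=
      (α.2.2.2 ⟨V, h⟩ (i + q) j ⟨app X f.1, hX⟩ Y).symm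
    have e2 : f.1 * contract h α (i + j) (bracket X Y) =
        contract h α (q + (i + j)) (mulVF f (bracket X Y)) :=
      (α.2.2.2 ⟨V, h⟩ q (i + j) f (bracket X Y)).symm
    have c : ∀ (k l : ℤ) (e : k = l) (Z : 𝓜.VectorField V k) (Z' : 𝓜.VectorField V l),
        Z.1 = Z'.1 → contract h α k Z = contract h α l Z' := by
      rintro k _ rfl Z Z' hZ
      rw [Subtype.ext hZ]
    rw [e1, e2, c (i + q + j) (i + (q + j)) (by ring) _
      ⟨(mulVF ⟨app X f.1, hX⟩ Y).1, by rw [← add_assoc]; exact (mulVF _ Y).2⟩ rfl,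
      c (q + (i + j)) (i + (q + j)) (by ring) _
      ⟨(mulVF f (bracket X Y)).1, by
        rw [show i + (q + j) = q + (i + j) by ring]; exact (mulVF f _).2⟩ rfl,
      ← map_smul, ← map_add]
    congr 1
    ext W a
    have hr : 𝓜.res (Set.mem_Iic.1 W.2) (app X f.1) = X.1 W (𝓜.res (Set.mem_Iic.1 W.2) f.1) :=
      X.2.1 ⟨V, le_refl V⟩ W _ _
    have hY : ∀ c : 𝓜.A W.1, (mulVF f Y).1 W c = 𝓜.res (Set.mem_Iic.1 W.2) f.1 * Y.1 W c :=
      fun c => rfl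
    have hB : ∀ c : 𝓜.A W.1, (mulVF f (bracket X Y)).1 W c =
        𝓜.res (Set.mem_Iic.1 W.2) f.1 * (bracket X Y).1 W c := fun c => rfl
    have hD : (mulVF ⟨app X f.1, hX⟩ Y).1 W a =
        𝓜.res (Set.mem_Iic.1 W.2) (app X f.1) * Y.1 W a := rfl
    simp only [bracket_apply, hY, Submodule.coe_add, Submodule.coe_smul, Operators.add_apply,
      Operators.smul_apply, LinearMap.add_apply, LinearMap.smul_apply, hB, hD, hr,
      X.2.2.2 W q _ (𝓜.res_mem (Set.mem_Iic.1 W.2) q f.1 f.2), mul_sub, smul_sub,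
      mul_smul_comm, smul_smul]
    rw [mul_add i q j, zpow_add₀ (by norm_num)]
    abel
  have hf : app X (f.1 * contract h α j Y) = app X f.1 * contract h α j Y +
      (-1 : ℝ) ^ (i * q) • (f.1 * app X (contract h α j Y)) := X.2.2.2 ⟨V, le_refl V⟩ q f.1 f.2 _
  have hα : contract h α (q + j) (mulVF f Y) = f.1 * contract h α j Y :=
    α.2.2.2 ⟨V, h⟩ q j f Y
  have hm : ∀ a, app (mulVF f Y) a = f.1 * app Y a := fun a => by
    simp [app, mulVF, 𝓜.res_refl]
  have hs : (-1 : ℝ) ^ (i * q) * (-1 : ℝ) ^ (i * q) = 1 := by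
    rw [← zpow_add₀ (by norm_num), ← two_mul, zpow_mul]; norm_num
  have e4 : (-1 : ℝ) ^ (i * (q + j - 1)) = (-1 : ℝ) ^ (i * q) * (-1 : ℝ) ^ (i * (j - 1)) := by
    rw [← zpow_add₀ (by norm_num), add_sub_assoc, mul_add]
  have e5 : (-1 : ℝ) ^ (i * (q + j)) = (-1 : ℝ) ^ (i * q) * (-1 : ℝ) ^ (i * j) := by
    rw [← zpow_add₀ (by norm_num), mul_add]
  simp only [dContract, hα, hf, hb, hm, e4, e5]
  generalize (-1 : ℝ) ^ (i * (j - 1)) = t at *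
  generalize (-1 : ℝ) ^ (i * j) = u at *
  generalize (-1 : ℝ) ^ (i * q) = s at *
  simp only [mul_smul_comm, mul_sub]
  match_scalars <;> first | linear_combination t * hs | linear_combination (-t) * hs |
    linear_combination (-t * u) * hs | linear_combination 0 * hs

theorem res_dContract {U V W : Opens M} {n : ℤ} (h : V ≤ U) (h' : W ≤ V) (α : 𝓜.OneForm U n)
    {i j : ℤ} (X : 𝓜.VectorField V i) (Y : 𝓜.VectorField V j) :
    𝓜.res h' (dContract h α X Y) =
      dContract (le_trans h' h) α (resVF h' i X) (resVF h' j Y) := by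
  have hα : ∀ (k : ℤ) (Z : 𝓜.VectorField V k), 𝓜.res h' (contract h α k Z) =
      contract (le_trans h' h) α k (resVF h' k Z) := fun k Z =>
    α.2.1 ⟨V, h⟩ ⟨W, le_trans h' h⟩ h' k Z
  have hZ : ∀ (k : ℤ) (Z : 𝓜.VectorField V k) (a : 𝓜.A V), 𝓜.res h' (app Z a) =
      app (resVF h' k Z) (𝓜.res h' a) := fun k Z a => Z.2.1 ⟨V, le_refl V⟩ ⟨W, h'⟩ h' a
  simp only [dContract, map_smul, map_sub, hα, hZ]
  rfl

theorem dContract_mem {U V : Opens M} {n : ℤ} (h : V ≤ U) (α : 𝓜.OneForm U n)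
    {i j : ℤ} (X : 𝓜.VectorField V i) (Y : 𝓜.VectorField V j) :
    dContract h α X Y ∈ 𝓜.gr V (j + (i + n)) := by
  have hα : ∀ (k : ℤ) (Z : 𝓜.VectorField V k), contract h α k Z ∈ 𝓜.gr V (k + n) :=
    fun k Z => α.2.2.1 ⟨V, h⟩ k Z
  have hZ : ∀ (k l : ℤ) (Z : 𝓜.VectorField V k) (a : 𝓜.A V), a ∈ 𝓜.gr V l →
      app Z a ∈ 𝓜.gr V (k + l) := fun k l Z a => Z.2.2.1 ⟨V, le_refl V⟩ l a
  refine Submodule.smul_mem _ _ (Submodule.sub_mem _ (Submodule.sub_mem _ ?_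
    (Submodule.smul_mem _ _ (hZ _ _ Y _ (hα _ X)))) ?_)
  · rw [add_left_comm]; exact hZ _ _ X _ (hα _ Y)
  · rw [add_left_comm, ← add_assoc]; exact hα _ _

theorem dContract_add_left {U V : Opens M} {n : ℤ} (h : V ≤ U) (α : 𝓜.OneForm U n) {i j : ℤ}
    (X X' : 𝓜.VectorField V i) (Y : 𝓜.VectorField V j) :
    dContract h α (X + X') Y = dContract h α X Y + dContract h α X' Y := by
  have e : bracket (X + X') Y = bracket X Y + bracket X' Y :=
    LinearMap.map_add₂ (bracketHom V i j) X X' Y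
  simp only [dContract, e, map_add]
  simp only [app, Submodule.coe_add, Operators.add_apply, LinearMap.add_apply]
  module

theorem dContract_smul_left {U V : Opens M} {n : ℤ} (h : V ≤ U) (α : 𝓜.OneForm U n) {i j : ℤ}
    (c : ℝ) (X : 𝓜.VectorField V i) (Y : 𝓜.VectorField V j) :
    dContract h α (c • X) Y = c • dContract h α X Y := by
  have e : bracket (c • X) Y = c • bracket X Y := LinearMap.map_smul₂ (bracketHom V i j) c X Y
  simp only [dContract, e, map_smul]
  simp only [app, Submodule.coe_smul, Operators.smul_apply, LinearMap.smul_apply]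
  module

theorem dContract_add_right {U V : Opens M} {n : ℤ} (h : V ≤ U) (α : 𝓜.OneForm U n) {i j : ℤ}
    (X : 𝓜.VectorField V i) (Y Z : 𝓜.VectorField V j) :
    dContract h α X (Y + Z) = dContract h α X Y + dContract h α X Z := by
  have e : bracket X (Y + Z) = bracket X Y + bracket X Z := map_add (bracketHom V i j X) Y Z
  simp only [dContract, e, map_add]
  simp only [app, Submodule.coe_add, Operators.add_apply, LinearMap.add_apply]
  module

theorem dContract_smul_right {U V : Opens M} {n : ℤ} (h : V ≤ U) (α : 𝓜.OneForm U n) {i j : ℤ}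
    (c : ℝ) (X : 𝓜.VectorField V i) (Y : 𝓜.VectorField V j) :
    dContract h α X (c • Y) = c • dContract h α X Y := by
  have e : bracket X (c • Y) = c • bracket X Y := map_smul (bracketHom V i j X) c Y
  simp only [dContract, e, map_smul]
  simp only [app, Submodule.coe_smul, Operators.smul_apply, LinearMap.smul_apply]
  module

/-- The `1`-form `ι_X dα` of degree `|X| + n`. -/
noncomputable def iotaD {U V : Opens M} {n : ℤ} (h : V ≤ U) (α : 𝓜.OneForm U n) {i : ℤ}
    (X : 𝓜.VectorField V i) : 𝓜.OneForm V (i + n) :=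
  ⟨fun W _ =>
    { toFun := fun Y => dContract (le_trans (Set.mem_Iic.1 W.2) h) α
        (resVF (Set.mem_Iic.1 W.2) i X) Y
      map_add' := dContract_add_right _ _ _
      map_smul' := fun c Y => dContract_smul_right _ _ c _ Y },
    fun W _ h' _ Y => res_dContract _ h' α (resVF (Set.mem_Iic.1 W.2) i X) Y,
    fun W _ Y => dContract_mem _ α (resVF (Set.mem_Iic.1 W.2) i X) Y,
    fun W _ _ f Y => dContract_mulVF _ α (resVF (Set.mem_Iic.1 W.2) i X) f Y⟩

theorem iotaD_apply {U V : Opens M} {n : ℤ} (h : V ≤ U) (α : 𝓜.OneForm U n) {i : ℤ}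
    (X : 𝓜.VectorField V i) (W : Set.Iic V) (j : ℤ) (Y : 𝓜.VectorField W.1 j) :
    (iotaD h α X).1 W j Y = dContract (le_trans (Set.mem_Iic.1 W.2) h) α
      (resVF (Set.mem_Iic.1 W.2) i X) Y := rfl

/-- The map `X ↦ ι_X dα` from vector fields of degree `i` over `V` to `1`-forms over `V`. -/
noncomputable def flat {U V : Opens M} {n : ℤ} (h : V ≤ U) (α : 𝓜.OneForm U n) (i : ℤ) :
    𝓜.VectorField V i →ₗ[ℝ] 𝓜.OneForm V (i + n) where
  toFun := iotaD h α
  map_add' X X' := by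
    ext W j Y
    simp only [Submodule.coe_add, Pairings.add_apply, LinearMap.add_apply, iotaD_apply, map_add,
      dContract_add_left]
  map_smul' c X := by
    ext W j Y
    simp only [Submodule.coe_smul, Pairings.smul_apply, LinearMap.smul_apply, iotaD_apply,
      map_smul, dContract_smul_left, RingHom.id_apply]

/-- The map `X ↦ ι_X dα`, extended linearly to all vector fields. -/
noncomputable def flatTotal {U V : Opens M} {n : ℤ} (h : V ≤ U) (α : 𝓜.OneForm U n) :
    𝓜.VF V →ₗ[ℝ] 𝓜.Pairings V :=
  liftVF fun i => (𝓜.OneForm V (i + n)).subtype ∘ₗ flat h α i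

/-! ### Contact forms and contact vector fields -/

variable {n : ℤ}

/-- The `1`-form `α` vanishes at no point of the body: near each point `p` there is a vector field
`X` such that the function `ι_X α` is nonzero at `p`. Only functions of degree zero can be nonzero
at `p`, hence `X` may be taken of degree `-n`. -/
def NowhereVanishing (α : 𝓜.OneForm ⊤ n) : Prop :=
  ∀ p : M, ∃ (V : Opens M) (hp : p ∈ V) (X : 𝓜.VectorField V (-n)) (g : SmoothFun m V),
    contract le_top α (-n) X = 𝓜.body V g ∧ g ⟨p, hp⟩ ≠ 0

/-- The sections of degree `k` over `U` of the distribution `D`, the kernel of `X ↦ ι_X α`. -/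
noncomputable def Dist (α : 𝓜.OneForm ⊤ n) (U : Opens M) (k : ℤ) : Submodule ℝ (𝓜.VectorField U k) :=
  LinearMap.ker (contract le_top α k)

/-- Restriction of sections of `D`. -/
noncomputable def resDist (α : 𝓜.OneForm ⊤ n) {U V : Opens M} (h : V ≤ U) {k : ℤ} (Y : Dist α U k) :
    Dist α V k :=
  ⟨resVF h k Y.1, by
    have h1 : 𝓜.res h (contract le_top α k Y.1) = contract le_top α k (resVF h k Y.1) :=
      α.2.1 ⟨U, Set.mem_Iic.2 le_top⟩ ⟨V, Set.mem_Iic.2 le_top⟩ h k Y.1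
    have h2 : contract le_top α k Y.1 = 0 := Y.2
    rw [Dist, LinearMap.mem_ker, ← h1, h2, map_zero]⟩

/-- The product of a homogeneous function and a homogeneous section of `D`. -/
noncomputable def mulDist (α : 𝓜.OneForm ⊤ n) {U : Opens M} {q k : ℤ} (f : 𝓜.gr U q) (Y : Dist α U k) :
    Dist α U (q + k) :=
  ⟨mulVF f Y.1, by
    have h1 : contract le_top α (q + k) (mulVF f Y.1) = f.1 * contract le_top α k Y.1 :=
      α.2.2.2 ⟨U, Set.mem_Iic.2 le_top⟩ q k f Y.1
    have h2 : contract le_top α k Y.1 = 0 := Y.2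
    rw [Dist, LinearMap.mem_ker, h1, h2, mul_zero]⟩

/-- The sections of degree `l` over `U` of the dual `D*`: the left linear maps of degree `l` from
the sheaf of sections of `D` over `U` to the sheaf of functions. -/
def DualDist (α : 𝓜.OneForm ⊤ n) (U : Opens M) (l : ℤ) :
    Submodule ℝ (∀ (V : Set.Iic U) (k : ℤ), Dist α V.1 k →ₗ[ℝ] 𝓜.A V.1) where
  carrier := {φ |
    (∀ (V W : Set.Iic U) (h : W.1 ≤ V.1) (k : ℤ) (Y : Dist α V.1 k),
      𝓜.res h (φ V k Y) = φ W k (resDist α h Y)) ∧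
    (∀ (V : Set.Iic U) (k : ℤ) (Y : Dist α V.1 k), φ V k Y ∈ 𝓜.gr V.1 (k + l)) ∧
    (∀ (V : Set.Iic U) (q k : ℤ) (f : 𝓜.gr V.1 q) (Y : Dist α V.1 k),
      φ V (q + k) (mulDist α f Y) = f.1 * φ V k Y)}
  zero_mem' := ⟨fun _ _ _ _ _ => by simp, fun _ _ _ => by simp, fun _ _ _ _ _ => by simp⟩
  add_mem' := by
    rintro β γ ⟨h1, h2, h3⟩ ⟨g1, g2, g3⟩
    refine ⟨fun V W h k Y => ?_, fun V k Y => ?_, fun V q k f Y => ?_⟩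
    · simp [h1 V W h k Y, g1 V W h k Y]
    · exact Submodule.add_mem _ (h2 V k Y) (g2 V k Y)
    · simp [h3 V q k f Y, g3 V q k f Y, mul_add]
  smul_mem' := by
    rintro c β ⟨h1, h2, h3⟩
    refine ⟨fun V W h k Y => ?_, fun V k Y => ?_, fun V q k f Y => ?_⟩
    · simp [h1 V W h k Y]
    · exact Submodule.smul_mem _ c (h2 V k Y)
    · simp [h3 V q k f Y]

/-- The map `D → D*` induced by `X ↦ ι_X dα`. -/
noncomputable def flatDist (α : 𝓜.OneForm ⊤ n) (U : Opens M) (k : ℤ) (X : Dist α U k) :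
    DualDist α U (k + n) :=
  ⟨fun V j => (flat le_top α k X.1).1 V j ∘ₗ (Dist α V.1 j).subtype,
    fun V W h j Y => (flat le_top α k X.1).2.1 V W h j Y.1,
    fun V j Y => (flat le_top α k X.1).2.2.1 V j Y.1,
    fun V q j f Y => (flat le_top α k X.1).2.2.2 V q j f Y.1⟩

/-- A contact `1`-form of degree `n`: it is nowhere vanishing and `X ↦ ι_X dα` induces a
bijection from the kernel `D` of `α` to its dual. -/
def IsContactForm (α : 𝓜.OneForm ⊤ n) : Prop :=
  NowhereVanishing α ∧ ∀ (U : Opens M) (k : ℤ), Function.Bijective (flatDist α U k)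

/-- The contact vector fields: the bracket with `X` preserves the sheaf of sections of `D`. -/
def ContactVF (α : 𝓜.OneForm ⊤ n) : Submodule ℝ (𝓜.VF ⊤) where
  carrier := {X | ∀ (U : Opens M) (Y : 𝓜.VF U), contractTotal le_top α Y = 0 →
    contractTotal le_top α (bracketTotal U (resVFTotal le_top X) Y) = 0}
  zero_mem' := fun _ _ _ => by simp
  add_mem' := fun hX hX' U Y hY => by simp [hX U Y hY, hX' U Y hY]
  smul_mem' := fun c X hX U Y hY => by simp [hX U Y hY]

end NManifold

/-! The proof rests on a Reeb vector field `R` of degree `-n`, with `ι_R α = 1` and `ι_R dα = 0`. It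
splits every vector field as `Y = (Y - (ι_Y α) R) + (ι_Y α) R`, with first summand in `D`; hence a
`1`-form is determined by its values on `D` and on `R` (`oneForm_eq_zero`).

Locally, nonvanishing of `α` gives `X` with `ι_X α = 1`, and nondegeneracy gives `Z` in `D` with
`ι_Z dα = ι_X dα` on `D`. Then `R = X - Z` works: `ι_R dα` vanishes on `D`, and `ι_R ι_R dα = 0` for
reasons of degree when `n > 0` and by antisymmetry when `n = 0`. Nondegeneracy makes `R` unique, so
the local fields glue (`exists_isReeb`).

Since `dα` is symmetric up to sign, every form `ι_X dα` kills `R`. Thus pairing `dh = β + f α` with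
`R` forces `f` to be `R h` up to sign. With this `f`, the form `dh - f α` kills `R`, and on `D` it
equals some `ι_Z dα` with `Z` in `D`; hence it equals `ι_Z dα` everywhere
(`IsReeb.exists_decomposition`).

By the Cartan relations, a homogeneous `X` is contact exactly when `ι_X dα = (-1) ^ (|X| + 1) d(ι_X
α)` on `D` (`contract_bracket_eq_zero_iff`). So `X_h = (-1) ^ (k - n + 1) Z + h R` is contact with
`ι_{X_h} α = h`. A contact field with `ι_X α = 0` lies in `D` and is annihilated by `D → D*`, so it
is zero: contraction with `α` is bijective on contact fields. Inhomogeneous fields reduce to their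
components, because all the operations involved shift degrees by constants. -/

namespace NManifold

variable {m : ℕ} {M : Type*} [TopologicalSpace M] [ChartedSpace (EuclideanSpace ℝ (Fin m)) M]
  {𝓜 : NManifold m M}

/-! ### Homogeneous components -/

/-- The homogeneous component of degree `i` of a function. -/
noncomputable def proj {U : Opens M} (i : ℤ) : 𝓜.A U →ₗ[ℝ] 𝓜.A U :=
  GradedAlgebra.proj (𝓜.gr U) i

theorem proj_mem {U : Opens M} (i : ℤ) (a : 𝓜.A U) : proj i a ∈ 𝓜.gr U i :=
  (DirectSum.decompose (𝓜.gr U) a i).2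

theorem proj_of_mem {U : Opens M} {i : ℤ} {a : 𝓜.A U} (ha : a ∈ 𝓜.gr U i) : proj i a = a :=
  DirectSum.decompose_of_mem_same _ ha

theorem proj_of_mem_ne {U : Opens M} {i j : ℤ} {a : 𝓜.A U} (ha : a ∈ 𝓜.gr U i) (h : i ≠ j) :
    proj j a = 0 :=
  DirectSum.decompose_of_mem_ne _ ha h

theorem homogeneous_induction {U : Opens M} {P : 𝓜.A U → Prop}
    (homogeneous : ∀ i, ∀ a ∈ 𝓜.gr U i, P a) (add : ∀ a b, P a → P b → P (a + b)) (a : 𝓜.A U) :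
    P a :=
  DirectSum.Decomposition.inductionOn (𝓜.gr U) (homogeneous 0 0 (zero_mem _))
    (fun {i} a => homogeneous i a.1 a.2) add a

theorem eq_zero_of_proj {U : Opens M} {a : 𝓜.A U} (h : ∀ i, proj i a = 0) : a = 0 := by
  apply (DirectSum.decompose (𝓜.gr U)).injective
  rw [DirectSum.decompose_zero]
  exact DFinsupp.ext fun i => Subtype.ext (h i)

theorem proj_res {U V : Opens M} (h : V ≤ U) (i : ℤ) (a : 𝓜.A U) :
    proj i (𝓜.res h a) = 𝓜.res h (proj i a) := by
  induction a using homogeneous_induction with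
  | homogeneous j a ha =>
    by_cases hj : j = i
    · subst hj
      rw [proj_of_mem ha, proj_of_mem (𝓜.res_mem h _ _ ha)]
    · rw [proj_of_mem_ne ha hj, proj_of_mem_ne (𝓜.res_mem h _ _ ha) hj, map_zero]
  | add a b ha hb => simp only [map_add, ha, hb]

theorem eq_zero_of_mem_of_neg {U : Opens M} {k : ℤ} (hk : k < 0) {a : 𝓜.A U}
    (ha : a ∈ 𝓜.gr U k) : a = 0 := by
  rwa [𝓜.gr_neg U k hk, Submodule.mem_bot] at ha

theorem signTwist_of_mem {U : Opens M} (q : ℤ) {p : ℤ} {a : 𝓜.A U} (ha : a ∈ 𝓜.gr U p) :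
    signTwist q a = (-1 : ℝ) ^ (q * p) • a := by
  simp only [signTwist, LinearMap.comp_apply, LinearEquiv.coe_coe,
    DirectSum.decomposeLinearEquiv_apply, DirectSum.decompose_of_mem _ ha]
  erw [DirectSum.toModule_lof]
  rfl

theorem neg_one_zpow_mul_self (k : ℤ) : (-1 : ℝ) ^ k * (-1 : ℝ) ^ k = 1 := by
  rw [← mul_zpow]; norm_num

theorem signTwist_signTwist {U : Opens M} (q : ℤ) (a : 𝓜.A U) :
    signTwist q (signTwist q a) = a := by
  induction a using homogeneous_induction with
  | homogeneous p a ha =>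
    rw [signTwist_of_mem q ha, map_smul, signTwist_of_mem q ha, smul_smul,
      neg_one_zpow_mul_self, one_smul]
  | add a b ha hb => rw [map_add, map_add, ha, hb]

/-! ### Gluing functions along a sieve of open subsets -/

theorem sheaf_sieve (S : Set (Opens M)) (W : Opens M) (k : ℤ)
    (hcover : ∀ p ∈ W, ∃ V ∈ S, p ∈ V ∧ V ≤ W) (hdown : ∀ V ∈ S, ∀ V' ≤ V, V' ∈ S)
    (s : ∀ V : Opens M, V ∈ S → V ≤ W → 𝓜.A V)
    (hs : ∀ V hV h, s V hV h ∈ 𝓜.gr V k)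
    (hcompat : ∀ V hV h V' hV' h' (hle : V' ≤ V), 𝓜.res hle (s V hV h) = s V' hV' h') :
    ∃! a : 𝓜.A W, a ∈ 𝓜.gr W k ∧ ∀ V hV (h : V ≤ W), 𝓜.res h a = s V hV h := by
  have hW : sSup {V | V ∈ S ∧ V ≤ W} = W := by
    refine le_antisymm (sSup_le fun V hV => hV.2) fun p hp => ?_
    obtain ⟨V, hV, hpV, hVW⟩ := hcover p hp
    exact (le_sSup (show V ∈ {V | V ∈ S ∧ V ≤ W} from ⟨hV, hVW⟩)) hpV
  -- The sheaf axiom yields a section over `sSup T`, whose type depends on that open set. The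
  -- equality with `W` is therefore carried as a variable `W'` and eliminated by substitution.
  have key : ∀ T : Set (Opens M), (hT : ∀ V, V ∈ T ↔ V ∈ S ∧ V ≤ W) → ∀ W', (hW' : W' = W) →
      sSup T = W' → ∃! a : 𝓜.A W', a ∈ 𝓜.gr W' k ∧
        ∀ V (hV : V ∈ S) (h : V ≤ W), 𝓜.res (hW' ▸ h) a = s V hV h := by
    rintro T hT _ hW' rfl
    obtain ⟨a, ⟨ha, har⟩, hu⟩ := 𝓜.sheaf k T
      (fun V => s V.1 ((hT _).1 V.2).1 ((hT _).1 V.2).2) (fun V => hs _ _ _) (by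
        intro V V'
        have h1 := ((hT _).1 V.2)
        have h2 := ((hT _).1 V'.2)
        rw [hcompat V.1 h1.1 h1.2 (V.1 ⊓ V'.1) (hdown _ h1.1 _ inf_le_left)
          (inf_le_left.trans h1.2) inf_le_left,
          hcompat V'.1 h2.1 h2.2 (V.1 ⊓ V'.1) (hdown _ h1.1 _ inf_le_left)
          (inf_le_left.trans h1.2) inf_le_right])
    refine ⟨a, ⟨ha, fun V hV h => har ⟨V, (hT V).2 ⟨hV, h⟩⟩⟩, fun b hb => hu b ⟨hb.1, fun V => ?_⟩⟩
    exact hb.2 V.1 ((hT _).1 V.2).1 ((hT _).1 V.2).2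
  exact key _ (fun _ => Iff.rfl) W rfl hW

/-- A function vanishing locally is zero. -/
theorem eq_zero_of_res (S : Set (Opens M)) (W : Opens M)
    (hcover : ∀ p ∈ W, ∃ V ∈ S, p ∈ V ∧ V ≤ W) (hdown : ∀ V ∈ S, ∀ V' ≤ V, V' ∈ S)
    (a : 𝓜.A W) (ha : ∀ V ∈ S, ∀ h : V ≤ W, 𝓜.res h a = 0) : a = 0 := by
  refine eq_zero_of_proj fun i => ?_
  obtain ⟨b, -, hu⟩ := sheaf_sieve (𝓜 := 𝓜) S W i hcover hdown (fun _ _ _ => 0)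
    (fun _ _ _ => zero_mem _) (fun _ _ _ _ _ _ _ => map_zero _)
  rw [hu (proj i a) ⟨proj_mem i a, fun V hV h => by rw [← proj_res, ha V hV h, map_zero]⟩,
    hu 0 ⟨zero_mem _, fun V hV h => map_zero _⟩]

theorem eq_of_res (S : Set (Opens M)) (W : Opens M)
    (hcover : ∀ p ∈ W, ∃ V ∈ S, p ∈ V ∧ V ≤ W) (hdown : ∀ V ∈ S, ∀ V' ≤ V, V' ∈ S)
    (a b : 𝓜.A W) (hab : ∀ V ∈ S, ∀ h : V ≤ W, 𝓜.res h a = 𝓜.res h b) : a = b :=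
  sub_eq_zero.1 <| eq_zero_of_res S W hcover hdown (a - b) fun V hV h => by
    rw [map_sub, hab V hV h, sub_self]

/-! ### Gluing vector fields -/

@[simp]
theorem resVF_apply {U V : Opens M} (h : V ≤ U) {k : ℤ} (X : 𝓜.VectorField U k) (W : Set.Iic V) :
    (resVF h k X).1 W = X.1 ⟨W.1, le_trans W.2 h⟩ := rfl

theorem res_app {U V : Opens M} (h : V ≤ U) {k : ℤ} (X : 𝓜.VectorField U k) (a : 𝓜.A U) :
    𝓜.res h (app X a) = app (resVF h k X) (𝓜.res h a) :=
  X.2.1 ⟨U, le_refl U⟩ ⟨V, h⟩ h a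

theorem app_mem {U : Opens M} {k i : ℤ} (X : 𝓜.VectorField U k) {a : 𝓜.A U}
    (ha : a ∈ 𝓜.gr U i) : app X a ∈ 𝓜.gr U (k + i) :=
  X.2.2.1 ⟨U, le_refl U⟩ i a ha

theorem app_mul {U : Opens M} {k i : ℤ} (X : 𝓜.VectorField U k) {a : 𝓜.A U}
    (ha : a ∈ 𝓜.gr U i) (b : 𝓜.A U) :
    app X (a * b) = app X a * b + (-1 : ℝ) ^ (k * i) • (a * app X b) :=
  X.2.2.2 ⟨U, le_refl U⟩ i a ha b

/-- The value on a homogeneous function is glued from the local values. Since gluing is available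
one degree at a time, general functions are reached by adding components. Linearity and the Leibniz
rule then hold because they hold locally. -/
theorem glue_vectorField (S : Set (Opens M)) (k : ℤ)
    (hcover : ∀ p : M, ∃ V ∈ S, p ∈ V) (hdown : ∀ V ∈ S, ∀ V' ≤ V, V' ∈ S)
    (X : ∀ V ∈ S, 𝓜.VectorField V k)
    (hX : ∀ V hV V' hV' (h : V' ≤ V), resVF h k (X V hV) = X V' hV') :
    ∃ Y : 𝓜.VectorField ⊤ k, ∀ V hV, resVF le_top k Y = X V hV := by
  have hc : ∀ W : Opens M, ∀ p ∈ W, ∃ V ∈ S, p ∈ V ∧ V ≤ W := fun W p hp => by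
    obtain ⟨V, hV, hpV⟩ := hcover p
    exact ⟨V ⊓ W, hdown V hV _ inf_le_left, ⟨hpV, hp⟩, inf_le_right⟩
  have hom : ∀ (W : Opens M) (i : ℤ), ∀ a ∈ 𝓜.gr W i, ∃ b ∈ 𝓜.gr W (k + i),
      ∀ V hV (h : V ≤ W), 𝓜.res h b = app (X V hV) (𝓜.res h a) := fun W i a ha => by
    obtain ⟨b, ⟨hb, hbr⟩, -⟩ := sheaf_sieve (𝓜 := 𝓜) S W (k + i) (hc W) hdown
      (fun V hV h => app (X V hV) (𝓜.res h a))
      (fun V hV h => app_mem _ (𝓜.res_mem h i a ha))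
      (fun V hV h V' hV' h' hle => by rw [res_app, hX V hV V' hV' hle, 𝓜.res_trans])
    exact ⟨b, hb, hbr⟩
  have ex : ∀ (W : Opens M) (a : 𝓜.A W), ∃ b : 𝓜.A W,
      ∀ V hV (h : V ≤ W), 𝓜.res h b = app (X V hV) (𝓜.res h a) := fun W a => by
    induction a using homogeneous_induction with
    | homogeneous i a ha =>
      obtain ⟨b, -, hb⟩ := hom W i a ha
      exact ⟨b, hb⟩
    | add a a' h h' =>
      obtain ⟨b, hb⟩ := h
      obtain ⟨b', hb'⟩ := h'
      exact ⟨b + b', fun V hV h => by rw [map_add, map_add, map_add, hb, hb']⟩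
  choose F hF using ex
  have uniq : ∀ (W : Opens M) (b b' : 𝓜.A W),
      (∀ V ∈ S, ∀ h : V ≤ W, 𝓜.res h b = 𝓜.res h b') → b = b' :=
    fun W b b' h => eq_of_res S W (hc W) hdown b b' h
  let Y : 𝓜.Operators ⊤ := fun W =>
    { toFun := F W.1
      map_add' := fun a b => uniq _ _ _ fun V hV h => by
        simp only [map_add, hF _ _ V hV h]
      map_smul' := fun c a => uniq _ _ _ fun V hV h => by
        simp only [map_smul, hF _ _ V hV h, RingHom.id_apply] }
  have hY : ∀ (W : Set.Iic (⊤ : Opens M)) a, Y W a = F W.1 a := fun _ _ => rfl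
  refine ⟨⟨Y, fun V W h a => ?_, fun V i a ha => ?_, fun V i a ha b => ?_⟩, fun V hV => ?_⟩
  · refine uniq _ _ _ fun V' hV' h' => ?_
    rw [hY, hY, 𝓜.res_trans, hF _ _ V' hV', hF _ _ V' hV', 𝓜.res_trans]
  · obtain ⟨b, hb, hbr⟩ := hom V.1 i a ha
    have : Y V a = b := uniq _ _ _ fun V' hV' h' => by
      rw [hY, hF _ _ V' hV', hbr]
    rwa [this]
  · refine uniq _ _ _ fun V' hV' h' => ?_
    simp only [hY, hF _ _ V' hV', map_mul, map_add, map_smul]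
    exact app_mul _ (𝓜.res_mem h' i a ha) _
  · ext W a
    refine uniq _ _ _ fun V' hV' h' => ?_
    have h1 : ((X V hV).1 W) a = app (resVF W.2 k (X V hV)) a := rfl
    rw [h1, hX V hV W.1 (hdown V hV _ W.2) W.2, res_app, hX _ _ V' hV' h']
    exact hF W.1 a V' hV' h'

/-! ### Change of the name of the degree -/

/-- A vector field of degree `k` regarded as one of degree `l = k`. -/
def castVF {U : Opens M} {k l : ℤ} (e : k = l) (X : 𝓜.VectorField U k) : 𝓜.VectorField U l :=
  ⟨X.1, e ▸ X.2⟩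

theorem pairing_castVF {U : Opens M} (β : 𝓜.Pairings U) (V : Set.Iic U) {k l : ℤ} (e : k = l)
    (X : 𝓜.VectorField V.1 k) : β V l (castVF e X) = β V k X := by
  subst e; rfl

theorem contract_castVF {U V : Opens M} {n : ℤ} (h : V ≤ U) (α : 𝓜.OneForm U n) {k l : ℤ}
    (e : k = l) (X : 𝓜.VectorField V k) : contract h α l (castVF e X) = contract h α k X :=
  pairing_castVF α.1 ⟨V, h⟩ e X

/-! ### Components of vector fields -/

/-- The component of degree `i` of a vector field. -/
noncomputable def compVF {U : Opens M} (i : ℤ) : 𝓜.VF U →ₗ[ℝ] 𝓜.VectorField U i :=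
  DirectSum.component ℝ ℤ (fun k => 𝓜.VectorField U k) i

theorem compVF_ofVF_same {U : Opens M} {i : ℤ} (X : 𝓜.VectorField U i) :
    compVF i (ofVF i X) = X :=
  DirectSum.component.lof_self ℝ (M := fun k => 𝓜.VectorField U k) i X

theorem compVF_ofVF_ne {U : Opens M} {i j : ℤ} (h : i ≠ j) (X : 𝓜.VectorField U i) :
    compVF j (ofVF i X) = 0 := by
  exact (DirectSum.component.of ℝ (M := fun k => 𝓜.VectorField U k) j i X).trans (dif_neg h)

theorem liftVF_ofVF {U : Opens M} {E : Type*} [AddCommMonoid E] [Module ℝ E]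
    (F : ∀ k : ℤ, 𝓜.VectorField U k →ₗ[ℝ] E) (k : ℤ) (X : 𝓜.VectorField U k) :
    liftVF F (ofVF k X) = F k X :=
  DirectSum.toModule_lof ℝ (M := fun k => 𝓜.VectorField U k) k X

theorem VF_induction {U : Opens M} {P : 𝓜.VF U → Prop} (zero : P 0)
    (of : ∀ i (X : 𝓜.VectorField U i), P (ofVF i X)) (add : ∀ X Y, P X → P Y → P (X + Y))
    (X : 𝓜.VF U) : P X :=
  DirectSum.induction_on X zero of add

theorem VF_ext {U : Opens M} {X Y : 𝓜.VF U} (h : ∀ i, compVF i X = compVF i Y) : X = Y :=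
  DFinsupp.ext h

theorem exists_eq_sum_ofVF {U : Opens M} (X : 𝓜.VF U) :
    ∃ s : Finset ℤ, X = ∑ i ∈ s, ofVF i (compVF i X) := by
  classical
  exact ⟨DFinsupp.support (β := fun k => 𝓜.VectorField U k) X,
    (DirectSum.sum_support_of (β := fun k => 𝓜.VectorField U k) X).symm⟩

/-! ### Contractions of one-forms -/

theorem mulVF_apply {U : Opens M} {q k : ℤ} (f : 𝓜.gr U q) (X : 𝓜.VectorField U k)
    (V : Set.Iic U) (a : 𝓜.A V.1) :
    (mulVF f X).1 V a = 𝓜.res (Set.mem_Iic.1 V.2) f.1 * X.1 V a := rfl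

theorem contract_mem {U V : Opens M} {n : ℤ} (h : V ≤ U) (α : 𝓜.OneForm U n) {k : ℤ}
    (X : 𝓜.VectorField V k) : contract h α k X ∈ 𝓜.gr V (k + n) :=
  α.2.2.1 ⟨V, h⟩ k X

theorem contract_mulVF {U V : Opens M} {n : ℤ} (h : V ≤ U) (α : 𝓜.OneForm U n) {q k : ℤ}
    (f : 𝓜.gr V q) (X : 𝓜.VectorField V k) :
    contract h α (q + k) (mulVF f X) = f.1 * contract h α k X :=
  α.2.2.2 ⟨V, h⟩ q k f X

theorem res_contract {U V W : Opens M} {n : ℤ} (h : V ≤ U) (h' : W ≤ V) (α : 𝓜.OneForm U n)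
    {k : ℤ} (X : 𝓜.VectorField V k) :
    𝓜.res h' (contract h α k X) = contract (h'.trans h) α k (resVF h' k X) :=
  α.2.1 ⟨V, h⟩ ⟨W, h'.trans h⟩ h' k X

/-! ### Symmetry of `dα` -/

theorem contract_bracket_comm {U V : Opens M} {n : ℤ} (h : V ≤ U) (α : 𝓜.OneForm U n) {i j : ℤ}
    (X : 𝓜.VectorField V i) (Y : 𝓜.VectorField V j) :
    contract h α (j + i) (bracket Y X) =
      -(-1 : ℝ) ^ (i * j) • contract h α (i + j) (bracket X Y) := by
  rw [← contract_castVF h α (add_comm j i), ← map_smul]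
  congr 1
  ext W a
  change (bracket Y X).1 W a = -(-1 : ℝ) ^ (i * j) • (bracket X Y).1 W a
  rw [bracket_apply, bracket_apply, smul_sub, smul_smul, neg_mul, neg_one_zpow_mul_self,
    mul_comm j i]
  module

/-- The `2`-form `dα` is graded symmetric up to a sign. -/
theorem dContract_comm {U V : Opens M} {n : ℤ} (h : V ≤ U) (α : 𝓜.OneForm U n) {i j : ℤ}
    (X : 𝓜.VectorField V i) (Y : 𝓜.VectorField V j) :
    ∃ c : ℝ, dContract h α Y X = c • dContract h α X Y := by
  -- Exchanging `X` and `Y` multiplies the three-term bracket expression by `-(-1) ^ (i * j)`; the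
  -- other two signs are the prefactors of the two contractions. Only the vanishing of contractions
  -- is transported later, so the constant stays existential.
  refine ⟨-((-1 : ℝ) ^ (j * (i - 1)) * (-1 : ℝ) ^ (i * j) * (-1 : ℝ) ^ (i * (j - 1))), ?_⟩
  have h1 := neg_one_zpow_mul_self (i * j)
  have h2 := neg_one_zpow_mul_self (i * (j - 1))
  simp only [dContract, contract_bracket_comm h α X Y, mul_comm j i]
  generalize (-1 : ℝ) ^ (i * (j - 1)) = t at *
  generalize (-1 : ℝ) ^ (i * j) = u at *
  generalize (-1 : ℝ) ^ (j * (i - 1)) = v at *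
  match_scalars
  · linear_combination (-v) * h1 * t ^ 2 - v * h2
  · linear_combination v * u * h2
  · linear_combination (-v * u) * h2

/-- Linearity over functions is known in the second argument, so the arguments are swapped, the
factor is pulled out, and they are swapped back. -/
theorem dContract_mulVF_left_eq_zero {U V : Opens M} {n : ℤ} (h : V ≤ U) (α : 𝓜.OneForm U n)
    {i j q : ℤ} (X : 𝓜.VectorField V i) (Y : 𝓜.VectorField V j) (f : 𝓜.gr V q)
    (hXY : dContract h α X Y = 0) : dContract h α (mulVF f X) Y = 0 := by
  obtain ⟨c, hc⟩ := dContract_comm h α X Y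
  obtain ⟨d, hd⟩ := dContract_comm h α Y (mulVF f X)
  rw [hd, dContract_mulVF, hc, hXY, smul_zero, mul_zero, smul_zero]

theorem dContract_self_eq_zero {U V : Opens M} {n : ℤ} (hn : 0 ≤ n) (h : V ≤ U)
    (α : 𝓜.OneForm U n) (X : 𝓜.VectorField V (-n)) (hX : contract h α (-n) X = 1) :
    dContract h α X X = 0 := by
  rcases hn.lt_or_eq with hn | rfl
  -- The double contraction has degree `-n + (-n + n) = -n`, and there are no functions of negative
  -- degree.
  · exact eq_zero_of_mem_of_neg (by linarith) (dContract_mem h α X X)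
  -- In degree zero the bracket is the ordinary commutator, so `[X, X] = 0` and the two derivative
  -- terms cancel.
  · have hb : bracket X X = 0 := by
      ext W a
      rw [bracket_apply]
      simp
    simp [dContract, hb]

/-! ### The Reeb vector field -/

variable {n : ℤ}

/-- A Reeb vector field over `U`: `ι_R α = 1` and `ι_R dα = 0`. -/
def IsReeb (α : 𝓜.OneForm ⊤ n) {U : Opens M} (R : 𝓜.VectorField U (-n)) : Prop :=
  contract le_top α (-n) R = 1 ∧ flat le_top α (-n) R = 0

theorem contract_resVF_eq_one {α : 𝓜.OneForm ⊤ n} {U V : Opens M} (h : V ≤ U)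
    {R : 𝓜.VectorField U (-n)} (hR : contract le_top α (-n) R = 1) :
    contract le_top α (-n) (resVF h (-n) R) = 1 := by
  rw [← res_contract le_top h α R, hR, map_one]

theorem IsReeb.res {α : 𝓜.OneForm ⊤ n} {U V : Opens M} (h : V ≤ U) {R : 𝓜.VectorField U (-n)}
    (hR : IsReeb α R) : IsReeb α (resVF h (-n) R) := by
  refine ⟨contract_resVF_eq_one h hR.1, Subtype.ext (Pairings.ext fun W j Y => ?_)⟩
  have h1 : (flat le_top α (-n) R).1 ⟨W.1, le_trans W.2 h⟩ j Y = 0 := by rw [hR.2]; rfl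
  exact h1

theorem IsReeb.dContract_left {α : 𝓜.OneForm ⊤ n} {U : Opens M} {R : 𝓜.VectorField U (-n)}
    (hR : IsReeb α R) {j : ℤ} (Y : 𝓜.VectorField U j) : dContract le_top α R Y = 0 := by
  have h1 : (flat le_top α (-n) R).1 ⟨U, le_refl U⟩ j Y = 0 := by rw [hR.2]; rfl
  exact h1

theorem IsReeb.dContract_right {α : 𝓜.OneForm ⊤ n} {U : Opens M} {R : 𝓜.VectorField U (-n)}
    (hR : IsReeb α R) {j : ℤ} (Y : 𝓜.VectorField U j) : dContract le_top α Y R = 0 := by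
  obtain ⟨c, hc⟩ := dContract_comm le_top α R Y
  rw [hc, hR.dContract_left, smul_zero]

/-- A `1`-form vanishing on `D` and on a vector field `R` with `ι_R α = 1` is zero. -/
theorem oneForm_eq_zero {α : 𝓜.OneForm ⊤ n} {U : Opens M} {R : 𝓜.VectorField U (-n)}
    (hR : contract le_top α (-n) R = 1) {l : ℤ} {β : 𝓜.Pairings U} (hβ : β ∈ 𝓜.OneForm U l)
    (hD : ∀ (V : Set.Iic U) (k : ℤ) (Y : 𝓜.VectorField V.1 k), Y ∈ Dist α V.1 k → β V k Y = 0)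
    (hβR : ∀ V : Set.Iic U, β V (-n) (resVF V.2 (-n) R) = 0) : β = 0 := by
  ext V k Y
  have e : k + n + -n = k := by ring
  let f : 𝓜.gr V.1 (k + n) := ⟨contract le_top α k Y, contract_mem le_top α Y⟩
  -- The component of `Y` along `R`, namely `(ι_Y α) R`; the difference `Y - Z` lies in `D`.
  let Z := castVF e (mulVF f (resVF V.2 (-n) R))
  have hZ : β V k Z = 0 := by
    rw [pairing_castVF, hβ.2.2, hβR, mul_zero]
  have hY : β V k (Y - Z) = 0 := hD V k _ <| by
    rw [Dist, LinearMap.mem_ker, map_sub, contract_castVF, contract_mulVF,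
      contract_resVF_eq_one V.2 hR, mul_one, sub_self]
  rwa [map_sub, hZ, sub_zero] at hY

/-- The difference is a section of `D` that maps to zero in `D*`, so the injective half of
nondegeneracy applies. -/
theorem eq_of_flatDist {α : 𝓜.OneForm ⊤ n} (hα : IsContactForm α) {U : Opens M} {k : ℤ}
    {X Y : 𝓜.VectorField U k} (hXY : contract le_top α k X = contract le_top α k Y)
    (h : ∀ (V : Set.Iic U) (j : ℤ) (Z : 𝓜.VectorField V.1 j), Z ∈ Dist α V.1 j →
      (flat le_top α k X).1 V j Z = (flat le_top α k Y).1 V j Z) : X = Y := by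
  have hD : X - Y ∈ Dist α U k := by rw [Dist, LinearMap.mem_ker, map_sub, hXY, sub_self]
  have h0 : (⟨X - Y, hD⟩ : Dist α U k) = 0 := (hα.2 U k).1 <| by
    refine Subtype.ext (funext fun V => funext fun j => LinearMap.ext fun Z => ?_)
    change (flat le_top α k (X - Y)).1 V j Z.1 = (flat le_top α k 0).1 V j Z.1
    rw [map_sub, map_zero]
    change (flat le_top α k X).1 V j Z.1 - (flat le_top α k Y).1 V j Z.1 = 0
    rw [h V j Z.1 Z.2, sub_self]
  exact sub_eq_zero.1 (congrArg Subtype.val h0)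

theorem IsReeb.unique {α : 𝓜.OneForm ⊤ n} (hα : IsContactForm α) {U : Opens M}
    {R R' : 𝓜.VectorField U (-n)} (hR : IsReeb α R) (hR' : IsReeb α R') : R = R' :=
  eq_of_flatDist hα (hR.1.trans hR'.1.symm) fun _ _ _ _ => by rw [hR.2, hR'.2]

/-- The restriction of a `1`-form to `D` is the restriction of `ι_Z dα` for a section `Z` of
`D`. -/
theorem exists_flat_eq_on_dist {α : 𝓜.OneForm ⊤ n} (hα : IsContactForm α) {U : Opens M} {k l : ℤ}
    (e : k + n = l) {β : 𝓜.Pairings U} (hβ : β ∈ 𝓜.OneForm U l) :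
    ∃ Z ∈ Dist α U k, ∀ (V : Set.Iic U) (j : ℤ) (Y : 𝓜.VectorField V.1 j), Y ∈ Dist α V.1 j →
      (flat le_top α k Z).1 V j Y = β V j Y := by
  subst e
  obtain ⟨Z, hZ⟩ := (hα.2 U k).2 ⟨fun V j => β V j ∘ₗ (Dist α V.1 j).subtype,
    fun V W h j Y => hβ.1 V W h j Y.1, fun V j Y => hβ.2.1 V j Y.1,
    fun V q j f Y => hβ.2.2 V q j f Y.1⟩
  refine ⟨Z.1, Z.2, fun V j Y hY => ?_⟩
  exact LinearMap.congr_fun (congrFun (congrFun (congrArg Subtype.val hZ) V) j) ⟨Y, hY⟩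

/-- Subtracting from `X` the section `Z` of `D` with the same contraction on `D` keeps `ι_X α = 1`
and makes `ι dα` vanish on `D`. It remains to pair the difference with itself, which gives zero. -/
theorem exists_isReeb_of_contract_eq_one (hn : 0 ≤ n) {α : 𝓜.OneForm ⊤ n} (hα : IsContactForm α)
    {U : Opens M} (X : 𝓜.VectorField U (-n)) (hX : contract le_top α (-n) X = 1) :
    ∃ R : 𝓜.VectorField U (-n), IsReeb α R := by
  obtain ⟨Z, hZ, h⟩ := exists_flat_eq_on_dist hα rfl (flat le_top α (-n) X).2
  have hR : contract le_top α (-n) (X - Z) = 1 := by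
    rw [map_sub, hX, show contract le_top α (-n) Z = 0 from hZ, sub_zero]
  refine ⟨X - Z, hR, Subtype.ext (oneForm_eq_zero hR (flat le_top α (-n) (X - Z)).2 ?_ ?_)⟩
  · intro V k Y hY
    rw [map_sub]
    exact sub_eq_zero.2 (h V k Y hY).symm
  · exact fun V => dContract_self_eq_zero hn le_top α _ (contract_resVF_eq_one V.2 hR)

/-- On the open set where `g` is nonzero, `X` can be multiplied by the smooth function `1 / g`; this
has degree zero, so the degree of the field is unchanged. -/
theorem exists_contract_eq_one {α : 𝓜.OneForm ⊤ n} (hα : NowhereVanishing α) (p : M) :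
    ∃ (V : Opens M) (_ : p ∈ V) (X : 𝓜.VectorField V (-n)), contract le_top α (-n) X = 1 := by
  obtain ⟨V, hp, X, g, hg, hgp⟩ := hα p
  have hcont : Continuous g := g.contMDiff.continuous
  let W : Opens M := ⟨Subtype.val '' {x : V | g x ≠ 0},
    V.isOpen.isOpenMap_subtype_val _ (isOpen_ne.preimage hcont)⟩
  have hWV : W ≤ V := by
    rintro _ ⟨x, -, rfl⟩
    exact x.2
  have hne : ∀ x : W, SmoothFun.res hWV g x ≠ 0 := by
    rintro ⟨_, x, hx, rfl⟩
    exact hx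
  let u : SmoothFun m W := ⟨fun x => (SmoothFun.res hWV g x)⁻¹,
    (SmoothFun.res hWV g).contMDiff.inv₀ hne⟩
  have hu : u * SmoothFun.res hWV g = 1 := ContMDiffMap.ext fun x => inv_mul_cancel₀ (hne x)
  have hb : 𝓜.body W u ∈ 𝓜.gr W 0 := by
    rw [← SetLike.mem_coe, ← 𝓜.body_range]
    exact ⟨u, rfl⟩
  refine ⟨W, ⟨⟨p, hp⟩, hgp, rfl⟩, castVF (zero_add _) (mulVF ⟨_, hb⟩ (resVF hWV (-n) X)), ?_⟩
  rw [contract_castVF, contract_mulVF, ← res_contract le_top hWV α X, hg, 𝓜.res_body, ← map_mul,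
    hu, map_one]

/-- The Reeb vector field of a contact form. -/
theorem exists_isReeb (hn : 0 ≤ n) {α : 𝓜.OneForm ⊤ n} (hα : IsContactForm α) :
    ∃ R : 𝓜.VectorField ⊤ (-n), IsReeb α R := by
  let S : Set (Opens M) := {V | ∃ R : 𝓜.VectorField V (-n), IsReeb α R}
  have hcover : ∀ p : M, ∃ V ∈ S, p ∈ V := fun p => by
    obtain ⟨V, hp, X, hX⟩ := exists_contract_eq_one hα.1 p
    exact ⟨V, exists_isReeb_of_contract_eq_one hn hα X hX, hp⟩
  have hdown : ∀ V ∈ S, ∀ V' ≤ V, V' ∈ S := fun V hV V' h => by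
    obtain ⟨R, hR⟩ := hV
    exact ⟨_, hR.res h⟩
  choose R hR using fun V (hV : V ∈ S) => hV
  -- Uniqueness of Reeb fields makes the chosen local ones compatible under restriction.
  obtain ⟨Y, hY⟩ := glue_vectorField S (-n) hcover hdown R
    fun V hV V' hV' h => ((hR V hV).res h).unique hα (hR V' hV')
  have h1 : contract le_top α (-n) Y = 1 := by
    refine eq_of_res S ⊤ (fun p _ => ?_) hdown _ _ fun V hV h => ?_
    · obtain ⟨V, hV, hp⟩ := hcover p
      exact ⟨V, hV, hp, le_top⟩
    · rw [res_contract, hY V hV, map_one]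
      exact (hR V hV).1
  refine ⟨Y, h1, Subtype.ext (Pairings.ext fun W j Z => ?_)⟩
  refine eq_of_res S W.1 (fun p hp => ?_) hdown _ _ fun V hV h => ?_
  · obtain ⟨V, hV, hpV⟩ := hcover p
    exact ⟨V ⊓ W, hdown V hV _ inf_le_left, ⟨hpV, hp⟩, inf_le_right⟩
  · rw [(flat le_top α (-n) Y).2.1 W ⟨V, Set.mem_Iic.2 le_top⟩ h]
    have h2 : resVF le_top (-n) Y = R V hV := hY V hV
    change dContract le_top α (resVF le_top (-n) Y) (resVF h j Z) = 𝓜.res h 0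
    rw [h2, (hR V hV).dContract_left, map_zero]

/-! ### The differential of a function and products of functions and forms -/

theorem dFun_apply {U : Opens M} (h : 𝓜.A U) (V : Set.Iic U) (k : ℤ) (Y : 𝓜.VectorField V.1 k) :
    dFun h V k Y = app Y (𝓜.res (Set.mem_Iic.1 V.2) h) := rfl

theorem mulForm_apply {U : Opens M} {l : ℤ} (f : 𝓜.A U) (β : 𝓜.OneForm U l) (V : Set.Iic U)
    (k : ℤ) (Y : 𝓜.VectorField V.1 k) :
    mulForm f β V k Y = signTwist (k - 1) (𝓜.res (Set.mem_Iic.1 V.2) f) * β.1 V k Y := rfl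

theorem dFun_add {U : Opens M} (h h' : 𝓜.A U) : dFun (h + h') = dFun h + dFun h' := by
  ext V k Y
  simp only [Pairings.add_apply, LinearMap.add_apply, dFun_apply, map_add]

theorem mulForm_add {U : Opens M} {l : ℤ} (f f' : 𝓜.A U) (β : 𝓜.OneForm U l) :
    mulForm (f + f') β = mulForm f β + mulForm f' β := by
  ext V k Y
  simp only [Pairings.add_apply, LinearMap.add_apply, mulForm_apply, map_add, add_mul]

theorem dFun_mem {U : Opens M} {k : ℤ} {h : 𝓜.A U} (hh : h ∈ 𝓜.gr U k) :
    dFun h ∈ 𝓜.OneForm U k := by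
  refine ⟨fun V W hWV j Y => ?_, fun V j Y => ?_, fun V q j f Y => ?_⟩
  · rw [dFun_apply, dFun_apply, res_app, 𝓜.res_trans]
  · exact app_mem Y (𝓜.res_mem _ k h hh)
  · change 𝓜.res (le_refl V.1) f.1 * _ = _
    rw [𝓜.res_refl]
    rfl

/-- Left linearity is the point: passing from `Y` to `g Y` changes the twist by `(-1) ^ (|g| |f|)`,
which is exactly the sign for moving `g` past `f`. -/
theorem mulForm_mem {U : Opens M} {q l : ℤ} {f : 𝓜.A U} (hf : f ∈ 𝓜.gr U q)
    (β : 𝓜.OneForm U l) : mulForm f β ∈ 𝓜.OneForm U (q + l) := by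
  have hr : ∀ {V : Opens M} (h : V ≤ U), 𝓜.res h f ∈ 𝓜.gr V q := fun h => 𝓜.res_mem h q f hf
  refine ⟨fun V W hWV j Y => ?_, fun V j Y => ?_, fun V p j g Y => ?_⟩
  · rw [mulForm_apply, mulForm_apply, signTwist_of_mem _ (hr _), signTwist_of_mem _ (hr _),
      map_mul, map_smul, 𝓜.res_trans, β.2.1 V W hWV]
  · rw [mulForm_apply, signTwist_of_mem _ (hr _), smul_mul_assoc, add_left_comm]
    exact Submodule.smul_mem _ _ (SetLike.mul_mem_graded (hr _) (β.2.2.1 V j Y))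
  · rw [mulForm_apply, mulForm_apply, signTwist_of_mem _ (hr _), signTwist_of_mem _ (hr _),
      β.2.2.2, smul_mul_assoc, smul_mul_assoc, mul_smul_comm, ← mul_assoc, ← mul_assoc,
      𝓜.graded_comm V.1 q p _ (hr _) g.1 g.2, smul_mul_assoc, smul_smul,
      ← zpow_add₀ (by norm_num)]
    rw [show (p + j - 1) * q + q * p = (j - 1) * q + 2 * (p * q) by ring,
      zpow_add₀ (by norm_num), zpow_mul _ 2]
    norm_num

/-! ### Components of the contractions -/

theorem contractTotal_ofVF {U V : Opens M} (h : V ≤ U) (α : 𝓜.OneForm U n) {i : ℤ}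
    (X : 𝓜.VectorField V i) : contractTotal h α (ofVF i X) = contract h α i X :=
  liftVF_ofVF _ i X

theorem flatTotal_ofVF {U V : Opens M} (h : V ≤ U) (α : 𝓜.OneForm U n) {i : ℤ}
    (X : 𝓜.VectorField V i) : flatTotal h α (ofVF i X) = (flat h α i X).1 :=
  liftVF_ofVF _ i X

theorem bracketTotal_ofVF {U : Opens M} {i j : ℤ} (X : 𝓜.VectorField U i)
    (Y : 𝓜.VectorField U j) :
    bracketTotal U (ofVF i X) (ofVF j Y) = ofVF (i + j) (bracket X Y) := by
  rw [bracketTotal, liftVF_ofVF, LinearMap.flip_apply, liftVF_ofVF]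
  rfl

theorem resVFTotal_ofVF {U V : Opens M} (h : V ≤ U) {i : ℤ} (X : 𝓜.VectorField U i) :
    resVFTotal h (ofVF i X) = ofVF i (resVF h i X) :=
  liftVF_ofVF _ i X

/-- The homogeneous components of a sum of homogeneous functions indexed by the components of a
vector field. -/
theorem proj_eq_of_ofVF {U V : Opens M} (T : 𝓜.VF U →ₗ[ℝ] 𝓜.A V)
    (F : ∀ i, 𝓜.VectorField U i →ₗ[ℝ] 𝓜.A V) (d : ℤ)
    (hT : ∀ i (X : 𝓜.VectorField U i), T (ofVF i X) = F i X)
    (hF : ∀ i (X : 𝓜.VectorField U i), F i X ∈ 𝓜.gr V (i + d)) (X : 𝓜.VF U) (i : ℤ) :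
    proj (i + d) (T X) = F i (compVF i X) := by
  induction X using VF_induction with
  | zero => simp only [map_zero]
  | of j X =>
    rw [hT]
    by_cases h : j = i
    · subst h
      rw [compVF_ofVF_same, proj_of_mem (hF j X)]
    · rw [compVF_ofVF_ne h, map_zero,
        proj_of_mem_ne (hF j X) (fun e => h (add_right_cancel e))]
  | add X Y hX hY => simp only [map_add, hX, hY]

theorem contract_compVF_eq_zero {U V : Opens M} (h : V ≤ U) (α : 𝓜.OneForm U n) {X : 𝓜.VF V}
    (hX : contractTotal h α X = 0) (i : ℤ) : contract h α i (compVF i X) = 0 := by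
  rw [← proj_eq_of_ofVF (contractTotal h α) (contract h α) n
    (fun i X => contractTotal_ofVF h α X) (fun i X => contract_mem h α X), hX, map_zero]

/-! ### Contact vector fields -/

/-- The Cartan formula for `ι_Y ι_X dα` solved for the bracket term; the summand `X (ι_Y α)` drops
out on `D`. -/
theorem contract_bracket_eq {α : 𝓜.OneForm ⊤ n} {U : Opens M} {i j : ℤ} (X : 𝓜.VectorField U i)
    {Y : 𝓜.VectorField U j} (hY : Y ∈ Dist α U j) :
    contract le_top α (i + j) (bracket X Y) =
      -((-1 : ℝ) ^ (i * j) • app Y (contract le_top α i X)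
        + (-1 : ℝ) ^ (i * (j - 1)) • dContract le_top α X Y) := by
  have hY0 : contract le_top α j Y = 0 := hY
  rw [dContract, hY0, smul_smul, neg_one_zpow_mul_self, map_zero]
  module

/-- The infinitesimal form of the contact condition: with `h = ι_X α`, it compares `ι_X dα` and `dh`
on `D`. Both directions serve, one for constructing contact fields and one for uniqueness. -/
theorem contract_bracket_eq_zero_iff {α : 𝓜.OneForm ⊤ n} {U : Opens M} {i j : ℤ}
    (X : 𝓜.VectorField U i) {Y : 𝓜.VectorField U j} (hY : Y ∈ Dist α U j) :
    contract le_top α (i + j) (bracket X Y) = 0 ↔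
      dContract le_top α X Y = (-1 : ℝ) ^ (i + 1) • app Y (contract le_top α i X) := by
  -- This exhibits the invertible sign common to both terms, leaving only `(-1) ^ i`, independent of
  -- `Y`.
  have h1 : (-1 : ℝ) ^ (i * j) = (-1 : ℝ) ^ (i * (j - 1)) * (-1 : ℝ) ^ i := by
    rw [← zpow_add₀ (by norm_num)]; congr 1; ring
  have h2 := neg_one_zpow_mul_self (i * (j - 1))
  rw [contract_bracket_eq X hY, neg_eq_zero, h1, mul_smul, ← smul_add, zpow_add_one₀ (by norm_num)]
  have h3 : (-1 : ℝ) ^ (i * (j - 1)) ≠ 0 := zpow_ne_zero _ (by norm_num)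
  rw [smul_eq_zero_iff_right h3, add_comm, ← eq_neg_iff_add_eq_zero]
  simp

theorem ofVF_mem_contactVF {α : 𝓜.OneForm ⊤ n} {i : ℤ} {X : 𝓜.VectorField ⊤ i}
    (hX : ∀ (U : Opens M) (j : ℤ) (Y : 𝓜.VectorField U j), Y ∈ Dist α U j →
      contract le_top α (i + j) (bracket (resVF le_top i X) Y) = 0) :
    ofVF i X ∈ ContactVF α := by
  intro U Y hY
  obtain ⟨s, hs⟩ := exists_eq_sum_ofVF Y
  rw [resVFTotal_ofVF, hs, map_sum, map_sum]
  refine Finset.sum_eq_zero fun j _ => ?_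
  rw [bracketTotal_ofVF, contractTotal_ofVF]
  exact hX U j _ (contract_compVF_eq_zero le_top α hY j)

/-- For homogeneous `Y`, the component of `X` of degree `i` contributes to `ι_[X,Y] α` only in
degree `i + (j + n)`. Distinct components cannot cancel, so each one is itself contact. -/
theorem contract_bracket_compVF_eq_zero {α : 𝓜.OneForm ⊤ n} {X : 𝓜.VF ⊤}
    (hX : X ∈ ContactVF α) (i : ℤ) {U : Opens M} {j : ℤ} {Y : 𝓜.VectorField U j}
    (hY : Y ∈ Dist α U j) :
    contract le_top α (i + j) (bracket (resVF le_top i (compVF i X)) Y) = 0 := by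
  have h := hX U (ofVF j Y) ((contractTotal_ofVF le_top α Y).trans hY)
  let T : 𝓜.VF ⊤ →ₗ[ℝ] 𝓜.A U :=
    contractTotal le_top α ∘ₗ (bracketTotal U).flip (ofVF j Y) ∘ₗ resVFTotal le_top
  let F : ∀ i, 𝓜.VectorField ⊤ i →ₗ[ℝ] 𝓜.A U := fun i =>
    contract le_top α (i + j) ∘ₗ (bracketHom U i j).flip Y ∘ₗ resVF le_top i
  have hT : T X = 0 := h
  have key := proj_eq_of_ofVF T F (j + n)
    (fun i X => by
      change contractTotal le_top α (bracketTotal U (resVFTotal le_top (ofVF i X)) (ofVF j Y)) = _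
      rw [resVFTotal_ofVF, bracketTotal_ofVF, contractTotal_ofVF]
      rfl)
    (fun i X => by
      rw [← add_assoc]
      exact contract_mem le_top α _) X i
  rw [hT, map_zero] at key
  exact key.symm

/-- A contact vector field is determined by its contraction with the contact form. -/
theorem contactVF_eq_zero {α : 𝓜.OneForm ⊤ n} (hα : IsContactForm α) {X : 𝓜.VF ⊤}
    (hX : X ∈ ContactVF α) (h : contractTotal le_top α X = 0) : X = 0 := by
  refine VF_ext fun i => ?_
  have h0 := contract_compVF_eq_zero le_top α h i
  rw [map_zero]
  refine eq_of_flatDist hα (h0.trans (map_zero _).symm) fun V j Z hZ => ?_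
  -- As `ι_X α = 0`, the contact condition reduces to `ι_X dα = 0` on `D`.
  have h1 := (contract_bracket_eq_zero_iff _ hZ).1 (contract_bracket_compVF_eq_zero hX i hZ)
  rw [← res_contract le_top le_top α, h0, map_zero, map_zero, smul_zero] at h1
  rw [map_zero]
  exact h1

/-- A vector field is determined by its contractions with `α` and `dα`. -/
theorem eq_zero_of_flatTotal {α : 𝓜.OneForm ⊤ n} (hα : IsContactForm α) {X : 𝓜.VF ⊤}
    (h : contractTotal le_top α X = 0) (hd : flatTotal le_top α X = 0) : X = 0 := by
  refine VF_ext fun i => ?_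
  rw [map_zero]
  refine eq_of_flatDist hα ((contract_compVF_eq_zero le_top α h i).trans (map_zero _).symm)
    fun V j Z _ => ?_
  -- Evaluation at the fixed `Z` turns forms into functions, where contributions of different
  -- components are separated by degree.
  let E : 𝓜.Pairings ⊤ →ₗ[ℝ] 𝓜.A V.1 :=
    { toFun := fun β => β V j Z, map_add' := fun _ _ => rfl, map_smul' := fun _ _ => rfl }
  have key := proj_eq_of_ofVF (E ∘ₗ flatTotal le_top α)
    (fun i => E ∘ₗ (𝓜.OneForm ⊤ (i + n)).subtype ∘ₗ flat le_top α i) (j + n)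
    (fun i X => by rw [LinearMap.comp_apply, flatTotal_ofVF]; rfl)
    (fun i X => by rw [add_left_comm]; exact (flat le_top α i X).2.2.1 V j Z) X i
  rw [LinearMap.comp_apply, hd, map_zero, map_zero] at key
  rw [map_zero]
  exact key.symm

/-! ### The decomposition of the differential of a function -/

theorem IsReeb.flatTotal_apply {α : 𝓜.OneForm ⊤ n} {R : 𝓜.VectorField ⊤ (-n)}
    (hR : IsReeb α R) (X : 𝓜.VF ⊤) : flatTotal le_top α X ⟨⊤, Set.mem_Iic.2 le_rfl⟩ (-n) R = 0 := by
  induction X using VF_induction with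
  | zero => rw [map_zero]; rfl
  | of i X => rw [flatTotal_ofVF]; exact hR.dContract_right X
  | add X Y hX hY => rw [map_add, Pairings.add_apply, LinearMap.add_apply, hX, hY, add_zero]

/-- Pairing with `R` kills the part in the image of `dα` and returns `f` up to the sign twist, which
is an involution. -/
theorem IsReeb.decomposition_unique {α : 𝓜.OneForm ⊤ n} {R : 𝓜.VectorField ⊤ (-n)}
    (hR : IsReeb α R) {β β' : 𝓜.Pairings ⊤} {f f' : 𝓜.A ⊤}
    (hβ : β ∈ LinearMap.range (flatTotal le_top α))
    (hβ' : β' ∈ LinearMap.range (flatTotal le_top α))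
    (h : β + mulForm f α = β' + mulForm f' α) : β = β' ∧ f = f' := by
  obtain ⟨X, rfl⟩ := hβ
  obtain ⟨X', rfl⟩ := hβ'
  have hv : ∀ (X : 𝓜.VF ⊤) (f : 𝓜.A ⊤),
      (flatTotal le_top α X + mulForm f α) ⟨⊤, Set.mem_Iic.2 le_rfl⟩ (-n) R = signTwist (-n - 1) f :=
    fun X f => by
      have h1 : α.1 ⟨⊤, Set.mem_Iic.2 le_rfl⟩ (-n) R = 1 := hR.1
      rw [Pairings.add_apply, LinearMap.add_apply, hR.flatTotal_apply, zero_add, mulForm_apply,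
        h1, mul_one, 𝓜.res_refl]
  have hf : f = f' := by
    rw [← signTwist_signTwist (-n - 1) f, ← hv X f, h, hv, signTwist_signTwist]
  subst hf
  exact ⟨add_right_cancel h, rfl⟩

theorem IsReeb.exists_decomposition {α : 𝓜.OneForm ⊤ n} (hα : IsContactForm α)
    {R : 𝓜.VectorField ⊤ (-n)} (hR : IsReeb α R) {i k : ℤ} (e : i + n = k) {h : 𝓜.A ⊤}
    (hh : h ∈ 𝓜.gr ⊤ k) :
    ∃ Z ∈ Dist α ⊤ i, ∃ f : 𝓜.A ⊤, dFun h = (flat le_top α i Z).1 + mulForm f α := by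
  have e' : -n + k + n = k := by ring
  have hRh : app R h ∈ 𝓜.gr ⊤ (-n + k) := app_mem R hh
  -- Since `|R| - 1 = -n - 1`, `ι_R (f α)` is the twist of `f` by `-n - 1`. Twisting `R h`
  -- beforehand makes it equal `R h = ι_R dh`.
  let f : 𝓜.A ⊤ := signTwist (-n - 1) (app R h)
  have hf : f ∈ 𝓜.gr ⊤ (-n + k) := by
    change signTwist (-n - 1) (app R h) ∈ _
    rw [signTwist_of_mem _ hRh]
    exact Submodule.smul_mem _ _ hRh
  have hmul : mulForm f α ∈ 𝓜.OneForm ⊤ k := by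
    have := mulForm_mem hf α
    rwa [e'] at this
  have hβ : dFun h - mulForm f α ∈ 𝓜.OneForm ⊤ k := Submodule.sub_mem _ (dFun_mem hh) hmul
  obtain ⟨Z, hZ, hZβ⟩ := exists_flat_eq_on_dist hα e hβ
  refine ⟨Z, hZ, f, ?_⟩
  have hflat : (flat le_top α i Z).1 ∈ 𝓜.OneForm ⊤ k := by
    have hle : 𝓜.OneForm ⊤ (i + n) ≤ 𝓜.OneForm ⊤ k := by rw [e]
    exact hle (flat le_top α i Z).2
  -- The two sides already agree on `D` by the choice of `Z`, so only agreement on `R` is left;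
  -- there `ι_Z dα` vanishes by symmetry.
  rw [← sub_eq_iff_eq_add, ← sub_eq_zero]
  refine oneForm_eq_zero hR.1 (Submodule.sub_mem _ hβ hflat) (fun V j Y hY => ?_) fun V => ?_
  · exact sub_eq_zero.2 (hZβ V j Y hY).symm
  · have h1 : (flat le_top α i Z).1 V (-n) (resVF (Set.mem_Iic.1 V.2) (-n) R) = 0 :=
      (hR.res (Set.mem_Iic.1 V.2)).dContract_right _
    have h2 : α.1 V (-n) (resVF (Set.mem_Iic.1 V.2) (-n) R) = 1 := (hR.res (Set.mem_Iic.1 V.2)).1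
    have h3 : 𝓜.res (Set.mem_Iic.1 V.2) f = signTwist (-n - 1) (𝓜.res (Set.mem_Iic.1 V.2) (app R h)) := by
      rw [signTwist_of_mem _ (𝓜.res_mem (Set.mem_Iic.1 V.2) _ _ hRh)]
      change 𝓜.res _ (signTwist (-n - 1) (app R h)) = _
      rw [signTwist_of_mem _ hRh, map_smul]
    change dFun h V (-n) _ - mulForm f α V (-n) _ - (flat le_top α i Z).1 V (-n) _ = 0
    rw [h1, mulForm_apply, h2, h3, signTwist_signTwist, dFun_apply, res_app, mul_one, sub_self,
      sub_zero]

theorem IsReeb.existsUnique_decomposition {α : 𝓜.OneForm ⊤ n} (hα : IsContactForm α)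
    {R : 𝓜.VectorField ⊤ (-n)} (hR : IsReeb α R) (h : 𝓜.A ⊤) :
    ∃! p : 𝓜.Pairings ⊤ × 𝓜.A ⊤, p.1 ∈ LinearMap.range (flatTotal le_rfl α) ∧
      dFun h = p.1 + mulForm p.2 α := by
  have ex : ∃ β ∈ LinearMap.range (flatTotal le_rfl α), ∃ f, dFun h = β + mulForm f α := by
    induction h using homogeneous_induction with
    | homogeneous k h hh =>
      obtain ⟨Z, -, f, hf⟩ := hR.exists_decomposition hα (sub_add_cancel k n) hh
      exact ⟨_, ⟨ofVF _ Z, flatTotal_ofVF le_rfl α Z⟩, f, hf⟩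
    | add a b ha hb =>
      obtain ⟨β, hβ, f, hf⟩ := ha
      obtain ⟨γ, hγ, g, hg⟩ := hb
      refine ⟨β + γ, Submodule.add_mem _ hβ hγ, f + g, ?_⟩
      rw [dFun_add, hf, hg, mulForm_add]
      abel
  obtain ⟨β, hβ, f, hf⟩ := ex
  refine ⟨(β, f), ⟨hβ, hf⟩, fun p hp => ?_⟩
  obtain ⟨h1, h2⟩ := hR.decomposition_unique hp.1 hβ (hp.2.symm.trans hf)
  exact Prod.ext h1 h2

/-! ### The contact vector field of a function -/

theorem resVF_mulVF {U V : Opens M} (h : V ≤ U) {q k : ℤ} (f : 𝓜.gr U q)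
    (X : 𝓜.VectorField U k) :
    resVF h (q + k) (mulVF f X) = mulVF ⟨𝓜.res h f.1, 𝓜.res_mem h q f.1 f.2⟩ (resVF h k X) := by
  ext W a
  rw [resVF_apply, mulVF_apply, mulVF_apply, 𝓜.res_trans]
  rfl

/-- This allows a multiple of `R` to be added to a field, prescribing `ι_X α` without disturbing
`ι_X dα`. -/
theorem IsReeb.flat_mulVF {α : 𝓜.OneForm ⊤ n} {U : Opens M} {R : 𝓜.VectorField U (-n)}
    (hR : IsReeb α R) {q l : ℤ} (e : q + -n = l) (f : 𝓜.gr U q) :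
    flat le_top α l (castVF e (mulVF f R)) = 0 := by
  subst e
  refine Subtype.ext (Pairings.ext fun W j Y => ?_)
  have h1 : dContract le_top α (resVF (Set.mem_Iic.1 W.2) (q + -n) (mulVF f R)) Y = 0 := by
    rw [resVF_mulVF]
    exact dContract_mulVF_left_eq_zero _ _ _ _ _ ((hR.res (Set.mem_Iic.1 W.2)).dContract_left Y)
  exact h1

theorem IsReeb.exists_contactVF {α : 𝓜.OneForm ⊤ n} (hα : IsContactForm α)
    {R : 𝓜.VectorField ⊤ (-n)} (hR : IsReeb α R) {k : ℤ} {h : 𝓜.A ⊤} (hh : h ∈ 𝓜.gr ⊤ k) :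
    ∃ X : 𝓜.VectorField ⊤ (k - n), ofVF _ X ∈ ContactVF α ∧ contract le_top α _ X = h ∧
      ∃ Z : 𝓜.VectorField ⊤ (k - n), ∃ f : 𝓜.A ⊤,
        dFun h = (flat le_top α _ Z).1 + mulForm f α ∧
        flat le_top α _ X = (-1 : ℝ) ^ (k - n + 1) • flat le_top α _ Z := by
  obtain ⟨Z, hZ, f, hf⟩ := hR.exists_decomposition hα (sub_add_cancel k n) hh
  let Y : 𝓜.VectorField ⊤ (k - n) := castVF (sub_eq_add_neg k n).symm (mulVF ⟨h, hh⟩ R)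
  have hY : flat le_top α _ Y = 0 := hR.flat_mulVF _ _
  -- The summand in `D` fixes `ι_X dα` and the multiple `h R` fixes `ι_X α`. The exponent `k - n +
  -- 1` is `|X| + 1`, as the contact condition demands.
  let X : 𝓜.VectorField ⊤ (k - n) := (-1 : ℝ) ^ (k - n + 1) • Z + Y
  have hX : contract le_top α _ X = h := by
    rw [map_add, map_smul, show contract le_top α (k - n) Z = 0 from hZ, smul_zero, zero_add,
      contract_castVF, contract_mulVF, hR.1, mul_one]
  have hXZ : flat le_top α _ X = (-1 : ℝ) ^ (k - n + 1) • flat le_top α _ Z := by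
    rw [map_add, map_smul, hY, add_zero]
  refine ⟨X, ofVF_mem_contactVF fun U j V hV => ?_, hX, Z, f, hf, hXZ⟩
  rw [contract_bracket_eq_zero_iff _ hV, ← res_contract le_top le_top α, hX]
  -- On `D` the term `f α` vanishes, so there `dh` and `ι_Z dα` coincide.
  have h1 : dFun h ⟨U, Set.mem_Iic.2 le_top⟩ j V =
      (flat le_top α _ Z).1 ⟨U, Set.mem_Iic.2 le_top⟩ j V := by
    have h2 : α.1 ⟨U, Set.mem_Iic.2 le_top⟩ j V = 0 := hV
    rw [hf, Pairings.add_apply, LinearMap.add_apply, mulForm_apply, h2, mul_zero, add_zero]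
  have h3 : (flat le_top α _ X).1 ⟨U, Set.mem_Iic.2 le_top⟩ j V =
      (-1 : ℝ) ^ (k - n + 1) • (flat le_top α _ Z).1 ⟨U, Set.mem_Iic.2 le_top⟩ j V := by
    rw [hXZ]; rfl
  rw [← h1] at h3
  exact h3

end NManifold

/-! ### Inverting contraction with the contact form -/

theorem mainTheorem7 {m : ℕ} {M : Type*} [TopologicalSpace M] [T2Space M]
    [SecondCountableTopology M] [ChartedSpace (EuclideanSpace ℝ (Fin m)) M]
    [IsManifold (𝓡 m) ∞ M] (𝓜 : NManifold m M) (n : ℕ) (α : 𝓜.OneForm ⊤ (n : ℤ))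
    (hα : NManifold.IsContactForm α) :
    (∀ h : 𝓜.A ⊤, ∃! p : 𝓜.Pairings ⊤ × 𝓜.A ⊤,
      p.1 ∈ LinearMap.range (NManifold.flatTotal le_rfl α) ∧
        NManifold.dFun h = p.1 + NManifold.mulForm p.2 α) ∧
    ∃ Φ : 𝓜.A ⊤ ≃ₗ[ℝ] NManifold.ContactVF α,
      (∀ h : 𝓜.A ⊤, NManifold.contractTotal le_rfl α (Φ h).1 = h) ∧
      (∀ (k : ℤ), ∀ h ∈ 𝓜.gr ⊤ k, ∀ (β : 𝓜.Pairings ⊤) (f : 𝓜.A ⊤),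
        β ∈ LinearMap.range (NManifold.flatTotal le_rfl α) →
        NManifold.dFun h = β + NManifold.mulForm f α →
        ∀ X : 𝓜.VF ⊤, X = (Φ h).1 ↔
          NManifold.flatTotal le_rfl α X = (-1 : ℝ) ^ (k - n + 1) • β ∧
            NManifold.contractTotal le_rfl α X = h) ∧
      ∀ (k : ℤ) (h : 𝓜.A ⊤), h ∈ 𝓜.gr ⊤ k ↔
        (Φ h).1 ∈ LinearMap.range
        (NManifold.ofVF (𝓜 := 𝓜) (U := ⊤) (k - n)) := by
  obtain ⟨R, hR⟩ := NManifold.exists_isReeb (Int.natCast_nonneg n) hα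
  let Γ : NManifold.ContactVF α →ₗ[ℝ] 𝓜.A ⊤ :=
    NManifold.contractTotal le_rfl α ∘ₗ (NManifold.ContactVF α).subtype
  have hinj : Function.Injective Γ := by
    rw [injective_iff_map_eq_zero]
    exact fun X hX => Subtype.ext (NManifold.contactVF_eq_zero hα X.2 hX)
  have hsurj : Function.Surjective Γ := by
    intro h
    induction h using NManifold.homogeneous_induction with
    | homogeneous k h hh =>
      obtain ⟨X, hX, hXh, -⟩ := hR.exists_contactVF hα hh
      exact ⟨⟨_, hX⟩, (NManifold.contractTotal_ofVF le_rfl α X).trans hXh⟩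
    | add a b ha hb =>
      obtain ⟨X, rfl⟩ := ha
      obtain ⟨Y, rfl⟩ := hb
      exact ⟨X + Y, map_add Γ X Y⟩
  let e := LinearEquiv.ofBijective Γ ⟨hinj, hsurj⟩
  have he : ∀ h, Γ (e.symm h) = h := e.apply_symm_apply
  have hΦ : ∀ (k : ℤ) (h) (_ : h ∈ 𝓜.gr ⊤ k) (X : 𝓜.VectorField ⊤ (k - n)),
      NManifold.ofVF _ X ∈ NManifold.ContactVF α → NManifold.contract le_top α _ X = h →
      (e.symm h).1 = NManifold.ofVF _ X := fun k h _ X hX hXh => by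
    have : e.symm h = ⟨_, hX⟩ := hinj <| (he h).trans <| hXh.symm.trans
      (NManifold.contractTotal_ofVF le_rfl α X).symm
    rw [this]
  refine ⟨hR.existsUnique_decomposition hα, e.symm, he, fun k h hh β f hβ hf X => ?_,
    fun k h => ⟨fun hh => ?_, ?_⟩⟩
  · obtain ⟨X', hX', hXh, Z, g, hg, hXZ⟩ := hR.exists_contactVF hα hh
    -- The given `β` must be the form `ι_Z dα` from which the contact field was built, by uniqueness
    -- of the decomposition.
    obtain ⟨rfl, -⟩ := hR.decomposition_unique hβ
      ⟨NManifold.ofVF _ Z, NManifold.flatTotal_ofVF le_top α Z⟩ (hf.symm.trans hg)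
    have h1 : NManifold.flatTotal le_rfl α (NManifold.ofVF _ X') =
        (-1 : ℝ) ^ (k - n + 1) • (NManifold.flat le_top α _ Z).1 := by
      rw [NManifold.flatTotal_ofVF, hXZ]
      rfl
    have h2 : NManifold.contractTotal le_rfl α (NManifold.ofVF _ X') = h :=
      (NManifold.contractTotal_ofVF le_rfl α X').trans hXh
    rw [hΦ k h hh X' hX' hXh]
    refine ⟨fun hX => hX ▸ ⟨h1, h2⟩, fun hX => sub_eq_zero.1 ?_⟩
    refine NManifold.eq_zero_of_flatTotal hα ?_ ?_
    · rw [map_sub, hX.2, h2, sub_self]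
    · rw [map_sub, hX.1, h1, sub_self]
  · obtain ⟨X, hX, hXh, -⟩ := hR.exists_contactVF hα hh
    exact ⟨X, (hΦ k h hh X hX hXh).symm⟩
  · rintro ⟨X, hX⟩
    have h1 : NManifold.contractTotal le_rfl α (e.symm h).1 = h := he h
    rw [← hX, NManifold.contractTotal_ofVF] at h1
    -- Contraction with `α` raises degree by `n`, so a field of degree `k - n` returns a function of
    -- degree `k`.
    have h2 := NManifold.contract_mem le_rfl α X
    rwa [h1, sub_add_cancel] at h2
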